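/- **Theorem 1.8.** There are a nondeterministic algorithm $A$ with access to a black box and a polynomial bound $T(n,d,L)=c\,(n+d+L+1)^k$, with absolute constants $c,k\in\mathbb{N}$, such that the following holds for all $n,d,L\in\mathbb{N}$. Let $f\in\mathbb{Q}[x_1,\dots,x_n]$ have total degree at most $d$, and let $p_1,\dots,p_n$ be nonzero univariate polynomials over $\mathbb{Q}$ of degree at most $d$, each without repeated roots in $\mathbb{C}$. Suppose that all numerators and denominators (in lowest terms) of the coefficients of the $p_i$, all numerators of the coefficients of $f$, and some common denominator of the coefficients of $f$ have at most $L$ bits. Let $I=\langle p_1(x_1),\dots,p_n(x_n)\rangle\subseteq\mathbb{Q}[x_1,\dots,x_n]$. The input of $A$ consists of $n,d,L$ and the list of the coefficients of the $p_i$, and $f$ is given only as a black box, which returns $f(a)$ (as a fraction in lowest terms) for any $a\in\mathbb{Q}^n$ chosen by the algorithm. Then every computation path of $A$ halts within time $T(n,d,L)$, and some computation path of $A$ accepts if and only if $f\notin I$. Here an algorithm is a program for a random access machine on unbounded integers (assignments, integer arithmetic, branching, loops, indirect addressing, guessing a bit, querying the black box), and time is bit cost: each operation is charged for the number of bits of the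 numbers and addresses that it handles, and each query for the bits of the question and of the answer. Up to polynomial factors this is the running time of nondeterministic oracle Turing machines. -/

import Mathlib

/-!
# Nondeterministic random access machines with a black box

Programs compute with integers of unbounded size that are kept in finitely many integer-indexed
arrays. Time is bit cost (the logarithmic cost criterion): every operation is charged for the
number of bits of the numbers and of the addresses it handles, so that polynomial time is the same
as polynomial time on (oracle) Turing machines.
-/

namespace BlackBoxMachine

/-- The number of binary digits of `|z|`. -/
def bitLen (z : ℤ) : ℕ := Nat.size z.natAbs

/-- `m x i` is the content of cell `i` of the array named `x`. A program mentions only finitely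
many arrays. -/
abbrev Memory := ℕ → ℤ → ℤ

/-- Write `z` into cell `i` of the array `x`. -/
def Memory.write (m : Memory) (x : ℕ) (i z : ℤ) : Memory :=
  Function.update m x (Function.update (m x) i z)

/-- Arithmetic expressions. `cell x e` reads the array `x` at the computed address `e`; `div` is
integer division with remainder (with value `0` if the divisor is `0`). -/
inductive Expr where
  | const (z : ℤ)
  | cell (x : ℕ) (e : Expr)
  | add (a b : Expr)
  | sub (a b : Expr)
  | mul (a b : Expr)
  | div (a b : Expr)

/-- The value of an expression. -/
def Expr.eval (m : Memory) : Expr → ℤ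
  | .const z => z
  | .cell x e => m x (e.eval m)
  | .add a b => a.eval m + b.eval m
  | .sub a b => a.eval m - b.eval m
  | .mul a b => a.eval m * b.eval m
  | .div a b => a.eval m / b.eval m

/-- The bit cost of evaluating an expression: every subexpression is charged one unit plus the
bit length of its value (so addresses and operands are charged as well). -/
def Expr.cost (m : Memory) : Expr → ℕ
  | .const z => bitLen z + 1
  | .cell x e => e.cost m + bitLen (m x (e.eval m)) + 1
  | .add a b => a.cost m + b.cost m + bitLen (a.eval m + b.eval m) + 1
  | .sub a b => a.cost m + b.cost m + bitLen (a.eval m - b.eval m) + 1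
  | .mul a b => a.cost m + b.cost m + bitLen (a.eval m * b.eval m) + 1
  | .div a b => a.cost m + b.cost m + bitLen (a.eval m / b.eval m) + 1

/-- Programs.
* `assign x i e`: put the value of `e` into cell `i` of the array `x`.
* `ite e P Q`: run `P` if `e` is positive, and `Q` otherwise.
* `loop e P`: while `e` is positive, run `P`.
* `guess x i`: put a nondeterministically chosen bit into cell `i` of the array `x`.
* `query x y u v`: ask the black box for its value at the rational point whose coordinates have
  their numerators in the array `x` and their denominators in the array `y` (cells `0, …, n - 1`);
  the numerator and the denominator of the answer, in lowest terms, are put into cell `0` of the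
  arrays `u` and `v`. -/
inductive Program where
  | skip
  | assign (x : ℕ) (i e : Expr)
  | seq (P Q : Program)
  | ite (e : Expr) (P Q : Program)
  | loop (e : Expr) (P : Program)
  | guess (x : ℕ) (i : Expr)
  | query (x y u v : ℕ)

/-- A state of a run: the memory, and the outcomes of all guesses still to come. -/
structure State where
  mem : Memory
  guesses : ℕ → Bool

/-- The point of `ℚⁿ` described by the arrays `x` (numerators) and `y` (denominators); a coordinate
with denominator `0` is read as `0`. -/
def queryPoint (n : ℕ) (m : Memory) (x y : ℕ) : Fin n → ℚ :=
  fun i => (m x ((i : ℕ) : ℤ) : ℚ) / (m y ((i : ℕ) : ℤ) : ℚ)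

/-- The cost of a query: the bits of the question and of the answer `a`. -/
def queryCost (n : ℕ) (m : Memory) (x y : ℕ) (a : ℚ) : ℕ :=
  (∑ i : Fin n, (bitLen (m x ((i : ℕ) : ℤ)) + bitLen (m y ((i : ℕ) : ℤ)) + 1))
    + bitLen a.num + bitLen a.den + 1

/-- `Exec F P s t s'`: with the black box `F : ℚⁿ → ℚ`, the program `P` started in state `s` halts
after time `t` in state `s'`. -/
inductive Exec {n : ℕ} (F : (Fin n → ℚ) → ℚ) : Program → State → ℕ → State → Prop where
  | skip (s : State) : Exec F .skip s 1 s
  | assign (x : ℕ) (i e : Expr) (s : State) :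
      Exec F (.assign x i e) s (i.cost s.mem + e.cost s.mem + 1)
        ⟨s.mem.write x (i.eval s.mem) (e.eval s.mem), s.guesses⟩
  | seq {P Q : Program} {s s' s'' : State} {t t' : ℕ} :
      Exec F P s t s' → Exec F Q s' t' s'' → Exec F (.seq P Q) s (t + t' + 1) s''
  | ite_pos {e : Expr} {P Q : Program} {s s' : State} {t : ℕ} :
      0 < e.eval s.mem → Exec F P s t s' → Exec F (.ite e P Q) s (e.cost s.mem + t + 1) s'
  | ite_neg {e : Expr} {P Q : Program} {s s' : State} {t : ℕ} :
      ¬ 0 < e.eval s.mem → Exec F Q s t s' → Exec F (.ite e P Q) s (e.cost s.mem + t + 1) s'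
  | loop_step {e : Expr} {P : Program} {s s' s'' : State} {t t' : ℕ} :
      0 < e.eval s.mem → Exec F P s t s' → Exec F (.loop e P) s' t' s'' →
        Exec F (.loop e P) s (e.cost s.mem + t + t' + 1) s''
  | loop_done {e : Expr} {P : Program} {s : State} :
      ¬ 0 < e.eval s.mem → Exec F (.loop e P) s (e.cost s.mem + 1) s
  | guess (x : ℕ) (i : Expr) (s : State) :
      Exec F (.guess x i) s (i.cost s.mem + 1)
        ⟨s.mem.write x (i.eval s.mem) (if s.guesses 0 then 1 else 0), fun k => s.guesses (k + 1)⟩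
  | query (x y u v : ℕ) (s : State) :
      Exec F (.query x y u v) s (queryCost n s.mem x y (F (queryPoint n s.mem x y)))
        ⟨(s.mem.write u 0 (F (queryPoint n s.mem x y)).num).write v 0
          ((F (queryPoint n s.mem x y)).den : ℤ), s.guesses⟩

/-- Every computation path of `P` started with memory `m` halts within time `T`. -/
def HaltsWithin {n : ℕ} (F : (Fin n → ℚ) → ℚ) (P : Program) (m : Memory) (T : ℕ) : Prop :=
  ∀ g : ℕ → Bool, ∃ (t : ℕ) (s : State), Exec F P ⟨m, g⟩ t s ∧ t ≤ T

/-- Some computation path of `P` started with memory `m` accepts, that is, halts with the number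
`1` in cell `0` of the array `3`. -/
def Accepts {n : ℕ} (F : (Fin n → ℚ) → ℚ) (P : Program) (m : Memory) : Prop :=
  ∃ (g : ℕ → Bool) (t : ℕ) (s : State), Exec F P ⟨m, g⟩ t s ∧ s.mem 3 0 = 1

/-- The initial memory. The array `0` holds `n, d, L`. The arrays `1` and `2` hold the numerators
and the denominators of the coefficients of `p₀, …, pₙ₋₁`: the coefficient of `xʲ` in `pᵢ`, for
`i < n` and `j ≤ d`, is at the address `i (d + 1) + j`. All other cells are `0`. -/
noncomputable def inputMemory {n : ℕ} (d L : ℕ) (p : Fin n → Polynomial ℚ) : Memory :=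
  fun x z =>
    if x = 0 then
      if z = 0 then n else if z = 1 then d else if z = 2 then L else 0
    else if h : 0 ≤ z ∧ z.toNat / (d + 1) < n then
      if x = 1 then ((p ⟨z.toNat / (d + 1), h.2⟩).coeff (z.toNat % (d + 1))).num
      else if x = 2 then ((p ⟨z.toNat / (d + 1), h.2⟩).coeff (z.toNat % (d + 1))).den
      else 0
    else 0

end BlackBoxMachine

/-- The ideal of `ℚ[x₁, …, xₙ]` generated by `p₁(x₁), …, pₙ(xₙ)`. -/
noncomputable def univariateIdeal {n : ℕ} (p : Fin n → Polynomial ℚ) :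
    Ideal (MvPolynomial (Fin n) ℚ) :=
  Ideal.span (Set.range fun i => Polynomial.aeval (MvPolynomial.X i : MvPolynomial (Fin n) ℚ) (p i))

/-- `p` is a nonzero polynomial without repeated complex roots. -/
def HasDistinctRoots (p : Polynomial ℚ) : Prop :=
  p ≠ 0 ∧ (p.map (algebraMap ℚ ℂ)).roots.Nodup

namespace BlackBoxMachine

/-! ### Bit lengths -/

/-! The `p i` have simple roots, so the ideal consists of all polynomials vanishing on the finite
grid Z of common complex zeros (`not_mem_univariateIdeal_iff`). Hence f is outside the ideal exactly
when f(α) ≠ 0 for some α in Z, and the guessed certificate is an approximation z of such an α.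

Put N = n + d + L + 1, V = N⁴, W = N⁵. Three estimates make approximate data decisive. Gap: for a
suitable nonzero integer A, the number A·f(α) is a nonzero algebraic integer, so its norm is a
nonzero integer and some conjugate has absolute value at least 1. Conjugation permutes the roots of
rational polynomials, so this gives another point of Z where |f| ≥ 2^(-3V) (`exists_norm_aeval_ge`).
Perturbation: on the polydisc that contains Z and its neighbourhood, f and the `p i` have Lipschitz
constant at most 2^(5N²). Converse: a small value of `p i` at z i forces a root near z i
(`exists_root_near`). Together: f is outside the ideal iff some z with Gaussian integer numerators
of at most 22W bits per part, over the denominator 2^(18W), satisfies |p i (z i)| < 2^(-11W) for all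
i and |f(z)| ≥ 2^(-4V) (`not_mem_iff_exists_gridPoint`).

The black box takes only rational points. Writing z = a + ib, the polynomial t ↦ f(a + tb) has
degree at most d; its values at t = 0, …, d are legitimate questions, and Lagrange interpolation
gives its value at t = i (`lagrangeSum_eq`).

All arithmetic is exact, with unreduced common denominators. Each loop step adds a controlled number
of bits, so every cell stays below a polynomial bound. `Triple` is a Hoare logic with running times;
the phases are verified in it and assembled in `nonmembershipProgram_spec`. -/

theorem bitLen_le {z : ℤ} {k : ℕ} : bitLen z ≤ k ↔ |z| < 2 ^ k := by
  rw [bitLen, Nat.size_le, Int.abs_eq_natAbs]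
  exact_mod_cast Iff.rfl

theorem abs_lt_two_pow_bitLen (z : ℤ) : |z| < 2 ^ bitLen z := bitLen_le.1 le_rfl

@[simp] theorem bitLen_zero : bitLen 0 = 0 := by simp [bitLen]

@[simp] theorem bitLen_one : bitLen 1 = 1 := by simp [bitLen]

@[simp] theorem bitLen_neg (z : ℤ) : bitLen (-z) = bitLen z := by simp [bitLen]

theorem bitLen_mono {y z : ℤ} (h : |y| ≤ |z|) : bitLen y ≤ bitLen z :=
  bitLen_le.2 (h.trans_lt (abs_lt_two_pow_bitLen z))

theorem bitLen_mul (y z : ℤ) : bitLen (y * z) ≤ bitLen y + bitLen z := by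
  rw [bitLen_le, abs_mul, pow_add]
  exact mul_lt_mul'' (abs_lt_two_pow_bitLen y) (abs_lt_two_pow_bitLen z) (abs_nonneg _)
    (abs_nonneg _)

theorem bitLen_add_le {y z : ℤ} {k : ℕ} (hy : bitLen y ≤ k) (hz : bitLen z ≤ k) :
    bitLen (y + z) ≤ k + 1 := by
  rw [bitLen_le] at *
  calc |y + z| ≤ |y| + |z| := abs_add_le _ _
    _ < 2 ^ k + 2 ^ k := add_lt_add hy hz
    _ = 2 ^ (k + 1) := by ring

theorem bitLen_sub_le {y z : ℤ} {k : ℕ} (hy : bitLen y ≤ k) (hz : bitLen z ≤ k) :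
    bitLen (y - z) ≤ k + 1 := by
  rw [sub_eq_add_neg]
  exact bitLen_add_le hy (by simpa using hz)

theorem bitLen_mul_le {y z : ℤ} {k l : ℕ} (hy : bitLen y ≤ k) (hz : bitLen z ≤ l) :
    bitLen (y * z) ≤ k + l := (bitLen_mul y z).trans (add_le_add hy hz)

theorem bitLen_natCast_le (k : ℕ) : bitLen (k : ℤ) ≤ k := by
  rw [bitLen_le]
  simpa using (by exact_mod_cast Nat.lt_two_pow_self : (k : ℤ) < 2 ^ k)

theorem bitLen_two_pow (k : ℕ) : bitLen (2 ^ k) = k + 1 := by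
  have : ((2 : ℤ) ^ k).natAbs = 2 ^ k := by simp [Int.natAbs_pow]
  rw [bitLen, this, Nat.size_pow]

theorem bitLen_ediv (y z : ℤ) : bitLen (y / z) ≤ bitLen y := by
  apply bitLen_mono
  rw [Int.abs_eq_natAbs, Int.abs_eq_natAbs]
  exact_mod_cast Int.natAbs_ediv_le_natAbs y z

/-! ### Costs of expressions -/

/-- All cells of `m` have at most `b` bits. -/
def Bdd (b : ℕ) (m : Memory) : Prop := ∀ x i, bitLen (m x i) ≤ b

theorem Bdd.write {b : ℕ} {m : Memory} (h : Bdd b m) {z : ℤ} (hz : bitLen z ≤ b) (x : ℕ) (i : ℤ) :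
    Bdd b (m.write x i z) := by
  intro y j
  unfold Memory.write
  by_cases hy : y = x
  · subst hy
    rw [Function.update_self]
    by_cases hj : j = i
    · subst hj; simpa using hz
    · rw [Function.update_of_ne hj]; exact h _ _
  · rw [Function.update_of_ne hy]; exact h _ _

theorem Bdd.mono {b b' : ℕ} {m : Memory} (h : Bdd b m) (hb : b ≤ b') : Bdd b' m :=
  fun x i => (h x i).trans hb

/-- A factor for the bit length of the value of an expression. -/
def Expr.growth : Expr → ℕ
  | .const z => bitLen z
  | .cell _ _ => 1
  | .add a b => a.growth + b.growth + 1
  | .sub a b => a.growth + b.growth + 1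
  | .mul a b => a.growth + b.growth + 1
  | .div a b => a.growth + b.growth + 1

/-- A factor for the cost of an expression. -/
def Expr.factor : Expr → ℕ
  | .const z => bitLen z + 1
  | .cell _ e => e.factor + 2
  | .add a b => a.factor + b.factor + a.growth + b.growth + 2
  | .sub a b => a.factor + b.factor + a.growth + b.growth + 2
  | .mul a b => a.factor + b.factor + a.growth + b.growth + 2
  | .div a b => a.factor + b.factor + a.growth + b.growth + 2

/-- Every operation yields at most the sum of the operand lengths plus one, so a fixed expression
produces values of length linear in `b`. Since `Bdd` controls all cells, the size of an address does
not matter for the value read. -/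
theorem Expr.bitLen_eval_le {b : ℕ} {m : Memory} (h : Bdd b m) (e : Expr) :
    bitLen (e.eval m) ≤ e.growth * (b + 1) := by
  induction e with
  | const z => simp only [Expr.eval, Expr.growth]; nlinarith [Nat.zero_le (bitLen z * b)]
  | cell x e _ => simp only [Expr.eval, Expr.growth]; linarith [h x (e.eval m)]
  | add a c ha hc =>
    have := bitLen_add_le (ha.trans (Nat.le_add_right _ _)) (hc.trans (Nat.le_add_left _ _))
    simp only [Expr.eval, Expr.growth]; nlinarith
  | sub a c ha hc =>
    have := bitLen_sub_le (ha.trans (Nat.le_add_right _ _)) (hc.trans (Nat.le_add_left _ _))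
    simp only [Expr.eval, Expr.growth]; nlinarith
  | mul a c ha hc =>
    have := bitLen_mul_le ha hc
    simp only [Expr.eval, Expr.growth]; nlinarith
  | div a c ha hc =>
    have := bitLen_ediv (a.eval m) (c.eval m)
    simp only [Expr.eval, Expr.growth]; nlinarith

theorem Expr.cost_le {b : ℕ} {m : Memory} (h : Bdd b m) (e : Expr) :
    e.cost m ≤ e.factor * (b + 1) := by
  induction e with
  | const z => simp only [Expr.cost, Expr.factor]; nlinarith [Nat.zero_le (bitLen z * b)]
  | cell x e he => simp only [Expr.cost, Expr.factor]; nlinarith [h x (e.eval m)]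
  | add a c ha hc =>
    have := Expr.bitLen_eval_le h (.add a c)
    simp only [Expr.cost, Expr.factor, Expr.eval, Expr.growth] at *; nlinarith
  | sub a c ha hc =>
    have := Expr.bitLen_eval_le h (.sub a c)
    simp only [Expr.cost, Expr.factor, Expr.eval, Expr.growth] at *; nlinarith
  | mul a c ha hc =>
    have := Expr.bitLen_eval_le h (.mul a c)
    simp only [Expr.cost, Expr.factor, Expr.eval, Expr.growth] at *; nlinarith
  | div a c ha hc =>
    have := Expr.bitLen_eval_le h (.div a c)
    simp only [Expr.cost, Expr.factor, Expr.eval, Expr.growth] at *; nlinarith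

/-! ### Runs -/

variable {n : ℕ} {F : (Fin n → ℚ) → ℚ}

/-- All nondeterminism sits in the stream of guesses stored in the state. This identifies a given
accepting run with the run produced by the specification. -/
theorem Exec.deterministic {P : Program} {s s₁ s₂ : State} {t₁ t₂ : ℕ}
    (h₁ : Exec F P s t₁ s₁) (h₂ : Exec F P s t₂ s₂) : t₁ = t₂ ∧ s₁ = s₂ := by
  induction h₁ generalizing t₂ s₂ with
  | skip s => cases h₂; exact ⟨rfl, rfl⟩
  | assign x i e s => cases h₂; exact ⟨rfl, rfl⟩
  | seq _ _ ih ih' =>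
    cases h₂ with
    | seq k k' =>
      obtain ⟨rfl, rfl⟩ := ih k
      obtain ⟨rfl, rfl⟩ := ih' k'
      exact ⟨rfl, rfl⟩
  | ite_pos hp _ ih =>
    cases h₂ with
    | ite_pos _ k => obtain ⟨rfl, rfl⟩ := ih k; exact ⟨rfl, rfl⟩
    | ite_neg hn _ => exact absurd hp hn
  | ite_neg hn _ ih =>
    cases h₂ with
    | ite_pos hp _ => exact absurd hp hn
    | ite_neg _ k => obtain ⟨rfl, rfl⟩ := ih k; exact ⟨rfl, rfl⟩
  | loop_step hp _ _ ih ih' =>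
    cases h₂ with
    | loop_step _ k k' =>
      obtain ⟨rfl, rfl⟩ := ih k
      obtain ⟨rfl, rfl⟩ := ih' k'
      exact ⟨rfl, rfl⟩
    | loop_done hn => exact absurd hp hn
  | loop_done hn =>
    cases h₂ with
    | loop_step hp _ _ => exact absurd hp hn
    | loop_done _ => exact ⟨rfl, rfl⟩
  | guess x i s => cases h₂; exact ⟨rfl, rfl⟩
  | query x y u v s => cases h₂; exact ⟨rfl, rfl⟩

/-- The arrays into which a program writes. -/
def Program.writes : Program → List ℕ
  | .skip => []
  | .assign x _ _ => [x]
  | .seq P Q => P.writes ++ Q.writes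
  | .ite _ P Q => P.writes ++ Q.writes
  | .loop _ P => P.writes
  | .guess x _ => [x]
  | .query _ _ u v => [u, v]

theorem Memory.write_of_ne (m : Memory) {x y : ℕ} (h : y ≠ x) (i z : ℤ) :
    m.write x i z y = m y := by
  simp [Memory.write, Function.update_of_ne h]

theorem Memory.write_apply (m : Memory) (x y : ℕ) (i j z : ℤ) :
    m.write x i z y j = if y = x ∧ j = i then z else m y j := by
  unfold Memory.write
  by_cases hy : y = x
  · subst hy
    rw [Function.update_self, Function.update_apply]
    simp
  · simp [hy]

/-- Frame rule: later phases recover the input, the thresholds and the guessed point without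
carrying them through the invariants. The side condition is decidable for concrete programs. -/
theorem Exec.frame {P : Program} {s s' : State} {t : ℕ} (h : Exec F P s t s') :
    ∀ y, y ∉ P.writes → s'.mem y = s.mem y := by
  induction h with
  | skip s => intros; rfl
  | assign x i e s =>
    intro y hy
    simp only [Program.writes, List.mem_singleton] at hy
    exact Memory.write_of_ne _ hy _ _
  | seq _ _ ih ih' =>
    intro y hy
    simp only [Program.writes, List.mem_append, not_or] at hy
    rw [ih' y hy.2, ih y hy.1]
  | ite_pos _ _ ih =>
    intro y hy
    simp only [Program.writes, List.mem_append, not_or] at hy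
    exact ih y hy.1
  | ite_neg _ _ ih =>
    intro y hy
    simp only [Program.writes, List.mem_append, not_or] at hy
    exact ih y hy.2
  | loop_step _ _ _ ih ih' =>
    intro y hy
    rw [ih' y hy, ih y hy]
  | loop_done _ => intros; rfl
  | guess x i s =>
    intro y hy
    simp only [Program.writes, List.mem_singleton] at hy
    exact Memory.write_of_ne _ hy _ _
  | query x y u v s =>
    intro y hy
    simp only [Program.writes, List.mem_cons, List.not_mem_nil, or_false, not_or] at hy
    exact (Memory.write_of_ne _ hy.2 _ _).trans (Memory.write_of_ne _ hy.1 _ _)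

/-- `P`, started in `s`, halts within time `T` in a state with property `Q`. -/
def Triple (F : (Fin n → ℚ) → ℚ) (P : Program) (s : State) (T : ℕ) (Q : State → Prop) : Prop :=
  ∃ (t : ℕ) (s' : State), Exec F P s t s' ∧ t ≤ T ∧ Q s'

theorem Triple.weaken {P : Program} {s : State} {T T' : ℕ} {Q Q' : State → Prop}
    (h : Triple F P s T Q) (hT : T ≤ T')
    (hQ : ∀ s', (∀ y, y ∉ P.writes → s'.mem y = s.mem y) → Q s' → Q' s') :
    Triple F P s T' Q' := by
  obtain ⟨t, s', he, ht, hq⟩ := h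
  exact ⟨t, s', he, ht.trans hT, hQ s' he.frame hq⟩

theorem Triple.seq {P P' : Program} {s : State} {T T' : ℕ} {Q Q' : State → Prop}
    (h : Triple F P s T Q)
    (h' : ∀ s', (∀ y, y ∉ P.writes → s'.mem y = s.mem y) → Q s' → Triple F P' s' T' Q') :
    Triple F (.seq P P') s (T + T' + 1) Q' := by
  obtain ⟨t, s', he, ht, hq⟩ := h
  obtain ⟨t', s'', he', ht', hq'⟩ := h' s' he.frame hq
  exact ⟨_, s'', he.seq he', by omega, hq'⟩

theorem Triple.assign {x : ℕ} {i e : Expr} {s : State} {b : ℕ} {Q : State → Prop}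
    (hb : Bdd b s.mem) (h : Q ⟨s.mem.write x (i.eval s.mem) (e.eval s.mem), s.guesses⟩) :
    Triple F (.assign x i e) s ((i.factor + e.factor + 1) * (b + 1)) Q :=
  ⟨_, _, .assign x i e s, by nlinarith [i.cost_le hb, e.cost_le hb], h⟩

/-! ### Programs without loops, guesses and queries -/

/-- No loops, guesses and queries occur. -/
def Program.straight : Program → Bool
  | .skip => true
  | .assign _ _ _ => true
  | .seq P Q => P.straight && Q.straight
  | .ite _ P Q => P.straight && Q.straight
  | _ => false

/-- The memory after the run of a program without loops, guesses and queries. -/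
def Program.run : Program → Memory → Memory
  | .assign x i e, m => m.write x (i.eval m) (e.eval m)
  | .seq P Q, m => Q.run (P.run m)
  | .ite e P Q, m => if 0 < e.eval m then P.run m else Q.run m
  | _, m => m

/-- A factor for the growth of the bit length of the cells. -/
def Program.growth : Program → ℕ
  | .assign _ _ e => e.growth + 1
  | .seq P Q => Q.growth * (P.growth + 1)
  | .ite _ P Q => P.growth + Q.growth
  | _ => 1

/-- A factor for the running time of a program without loops, guesses and queries. -/
def Program.factor : Program → ℕ
  | .assign _ i e => i.factor + e.factor + 1
  | .seq P Q => P.factor + Q.factor * (P.growth + 1) + 1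
  | .ite e P Q => e.factor + P.factor + Q.factor + 1
  | _ => 1

/-- This serves only for intermediate memories within one straight pass. Iterating it around a loop
would give an exponential bound, so loop bodies restore the same `b` by explicit bit estimates. -/
theorem Program.bdd_run {P : Program} (hP : P.straight) {b : ℕ} {m : Memory} (h : Bdd b m) :
    Bdd (P.growth * (b + 1)) (P.run m) := by
  induction P generalizing b m with
  | skip => exact h.mono (by simp [Program.growth])
  | assign x i e =>
    simp only [Program.growth, Program.run]
    refine (h.mono ?_).write ((e.bitLen_eval_le h).trans ?_) _ _ <;> nlinarith
  | seq P Q ihP ihQ =>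
    simp only [Program.straight, Bool.and_eq_true] at hP
    simp only [Program.growth, Program.run]
    refine (ihQ hP.2 (ihP hP.1 h)).mono ?_
    rw [mul_assoc]
    exact Nat.mul_le_mul_left _ (by nlinarith)
  | ite e P Q ihP ihQ =>
    simp only [Program.straight, Bool.and_eq_true] at hP
    simp only [Program.growth, Program.run]
    split_ifs
    · exact (ihP hP.1 h).mono (Nat.mul_le_mul_right _ (Nat.le_add_right _ _))
    · exact (ihQ hP.2 h).mono (Nat.mul_le_mul_right _ (Nat.le_add_left _ _))
  | loop | guess | query => simp [Program.straight] at hP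

theorem Program.exec_run {P : Program} (hP : P.straight) {b : ℕ} {s : State} (h : Bdd b s.mem) :
    ∃ t ≤ P.factor * (b + 1), Exec F P s t ⟨P.run s.mem, s.guesses⟩ := by
  induction P generalizing b s with
  | skip => exact ⟨1, by simp [Program.factor], .skip s⟩
  | assign x i e =>
    refine ⟨_, ?_, .assign x i e s⟩
    simp only [Program.factor]
    nlinarith [i.cost_le h, e.cost_le h]
  | seq P Q ihP ihQ =>
    simp only [Program.straight, Bool.and_eq_true] at hP
    obtain ⟨t, ht, he⟩ := ihP hP.1 h
    obtain ⟨t', ht', he'⟩ := ihQ (s := ⟨P.run s.mem, s.guesses⟩) hP.2 (Program.bdd_run hP.1 h)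
    refine ⟨_, ?_, he.seq he'⟩
    simp only [Program.factor]
    have : Q.factor * (P.growth * (b + 1) + 1) ≤ Q.factor * (P.growth + 1) * (b + 1) := by
      rw [mul_assoc]
      exact Nat.mul_le_mul_left _ (by nlinarith)
    nlinarith
  | ite e P Q ihP ihQ =>
    simp only [Program.straight, Bool.and_eq_true] at hP
    have hc := e.cost_le h
    by_cases hp : 0 < e.eval s.mem
    · obtain ⟨t, ht, he⟩ := ihP hP.1 h
      refine ⟨_, ?_, .ite_pos hp (by simpa [Program.run, hp] using he)⟩
      simp only [Program.factor]
      nlinarith [Nat.zero_le (Q.factor * (b + 1))]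
    · obtain ⟨t, ht, he⟩ := ihQ hP.2 h
      refine ⟨_, ?_, .ite_neg hp (by simpa [Program.run, hp] using he)⟩
      simp only [Program.factor]
      nlinarith [Nat.zero_le (P.factor * (b + 1))]
  | loop | guess | query => simp [Program.straight] at hP

theorem Triple.straight {P : Program} (hP : P.straight) {b : ℕ} {s : State} (h : Bdd b s.mem)
    {Q : State → Prop} (hQ : Q ⟨P.run s.mem, s.guesses⟩) :
    Triple F P s (P.factor * (b + 1)) Q := by
  obtain ⟨t, ht, he⟩ := Program.exec_run (F := F) hP h
  exact ⟨t, _, he, ht, hQ⟩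

/-! ### Counting loops -/

/-- The expression for a variable, which is cell `0` of the array of that name. -/
abbrev Expr.var (x : ℕ) : Expr := .cell x (.const 0)

/-- Run the program for the values `0, 1, …, e - 1` of the variable `x`. -/
def forLoop (x : ℕ) (e : Expr) (P : Program) : Program :=
  .seq (.assign x (.const 0) (.const 0))
    (.loop (.sub e (.var x)) (.seq P (.assign x (.const 0) (.add (.var x) (.const 1)))))

/-- A factor for the overhead of a counting loop. -/
def forFactor (e : Expr) : ℕ := e.factor + e.growth + 20

/-- `Inv` is asserted with the counter already set, hence the write in the conclusion of `hstep`.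
The bound `e` is re-evaluated in every round, and `he` keeps it constant as long as only the counter
and the arrays of the body change. -/
theorem Triple.forLoop {x : ℕ} {e : Expr} {P : Program} {s : State} {b M τ : ℕ}
    {Inv : ℕ → State → Prop} (hx : x ∉ P.writes)
    (he : ∀ s' : State, (∀ y, y ≠ x → y ∉ P.writes → s'.mem y = s.mem y) → e.eval s'.mem = M)
    (hM : bitLen M ≤ b) (hb : Bdd b s.mem) (h0 : Inv 0 ⟨s.mem.write x 0 0, s.guesses⟩)
    (hstep : ∀ k < M, ∀ s' : State, (∀ y, y ≠ x → y ∉ P.writes → s'.mem y = s.mem y) →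
      s'.mem x 0 = k → Bdd b s'.mem → Inv k s' →
      Triple F P s' τ fun s'' =>
        Bdd b s''.mem ∧ Inv (k + 1) ⟨s''.mem.write x 0 (k + 1), s''.guesses⟩) :
    Triple F (forLoop x e P) s ((M + 1) * (τ + forFactor e * (b + 1))) fun s' =>
      s'.mem x 0 = M ∧ Bdd b s'.mem ∧ Inv M s' := by
  -- Induction on the number `j` of rounds still to run.
  have key : ∀ j k : ℕ, k + j = M → ∀ s' : State,
      (∀ y, y ≠ x → y ∉ P.writes → s'.mem y = s.mem y) →
      s'.mem x 0 = k → Bdd b s'.mem → Inv k s' →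
      Triple F (.loop (.sub e (.var x)) (.seq P (.assign x (.const 0)
        (.add (.var x) (.const 1))))) s'
        (j * (τ + forFactor e * (b + 1)) + (e.factor + e.growth + 6) * (b + 1) + 1) fun s' =>
      s'.mem x 0 = M ∧ Bdd b s'.mem ∧ Inv M s' := by
    intro j
    induction j with
    | zero =>
      intro k hk s' hf hxk hb' hI
      obtain rfl : k = M := by simpa using hk
      have hc := Expr.cost_le hb' (.sub e (.var x))
      refine ⟨_, s', .loop_done ?_, ?_, hxk, hb', hI⟩
      · simp [Expr.eval, he s' hf, hxk]
      · simp only [Expr.factor, Expr.growth, bitLen_zero] at hc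
        nlinarith
    | succ j ih =>
      intro k hk s' hf hxk hb' hI
      obtain ⟨t, s₁, hex, ht, hb₁, hI₁⟩ := hstep k (by omega) s' hf hxk hb' hI
      have hf₁ : ∀ y, y ∉ P.writes → s₁.mem y = s'.mem y := hex.frame
      have hxk₁ : s₁.mem x 0 = k := by rw [hf₁ x hx, hxk]
      have hkM : bitLen ((k : ℤ) + 1) ≤ b := (bitLen_mono (by
        rw [abs_of_nonneg (by positivity), abs_of_nonneg (by positivity)]
        exact_mod_cast (by omega : k + 1 ≤ M))).trans hM
      obtain ⟨t₂, s₂, hex₂, ht₂, hQ⟩ := ih (k + 1) (by omega)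
        ⟨s₁.mem.write x 0 (k + 1), s₁.guesses⟩
        (fun y hy hy' => (Memory.write_of_ne _ hy _ _).trans (by rw [hf₁ y hy', hf y hy hy']))
        (by simp [Memory.write_apply]) (hb₁.write hkM _ _) hI₁
      have hasg := Exec.assign (F := F) x (.const 0) (.add (.var x) (.const 1)) s₁
      have hca := Expr.cost_le hb₁ (.add (.var x) (.const 1))
      have hc := Expr.cost_le hb' (.sub e (.var x))
      simp only [Expr.eval, hxk₁] at hasg
      refine ⟨_, s₂, .loop_step ?_ (.seq hex hasg) hex₂, ?_, hQ⟩
      · simp only [Expr.eval, he s' hf, hxk]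
        have : (k : ℤ) < M := by exact_mod_cast (by omega : k < M)
        linarith
      · simp only [Expr.factor, Expr.growth, bitLen_zero, bitLen_one] at hc hca
        simp only [Expr.cost, bitLen_zero, forFactor] at *
        nlinarith
  have hasg := Exec.assign (F := F) x (.const 0) (.const 0) s
  simp only [Expr.eval] at hasg
  obtain ⟨t₂, s₂, hex₂, ht₂, hQ⟩ := key M 0 (by omega) ⟨s.mem.write x 0 0, s.guesses⟩
    (fun y hy _ => Memory.write_of_ne _ hy _ _) (by simp [Memory.write_apply])
    (hb.write (by simp) _ _) h0
  refine ⟨_, s₂, hasg.seq hex₂, ?_, hQ⟩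
  simp only [Expr.cost, bitLen_zero, forFactor] at *
  nlinarith

end BlackBoxMachine

namespace BlackBoxMachine

variable {n : ℕ} {F : (Fin n → ℚ) → ℚ}

theorem Triple.guess {x : ℕ} {i : Expr} {s : State} {b : ℕ} {Q : State → Prop}
    (hb : Bdd b s.mem)
    (h : Q ⟨s.mem.write x (i.eval s.mem) (if s.guesses 0 then 1 else 0),
      fun k => s.guesses (k + 1)⟩) :
    Triple F (.guess x i) s ((i.factor + 1) * (b + 1)) Q :=
  ⟨_, _, .guess x i s, by nlinarith [i.cost_le hb], h⟩

theorem bitLen_le_of_abs_le {y z : ℤ} {k : ℕ} (h : |y| ≤ |z|) (hz : bitLen z ≤ k) :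
    bitLen y ≤ k := (bitLen_mono h).trans hz

theorem bitLen_natCast_le_of_le {j k : ℕ} (h : j ≤ k) : bitLen (j : ℤ) ≤ k :=
  (bitLen_natCast_le j).trans h

theorem bitLen_two_pow_le {j k : ℕ} (h : j + 1 ≤ k) : bitLen (2 ^ j) ≤ k :=
  (bitLen_two_pow j).le.trans h

/-! ### Parameters -/

/-- Raise two variables to powers of two. -/
def powerBody : Program :=
  .seq (.assign 12 (.const 0) (.mul (.const 2048) (.var 12)))
    (.assign 13 (.const 0) (.mul (.const 262144) (.var 13)))

/-- Raise a variable to a power of two. -/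
def thresholdBody : Program := .assign 11 (.const 0) (.mul (.const 16) (.var 11))

/-- Initialize the variables. -/
def initProgram : Program :=
  .seq (.assign 7 (.const 0) (.add (.add (.add (.cell 0 (.const 0)) (.cell 0 (.const 1)))
      (.cell 0 (.const 2))) (.const 1)))
    (.seq (.assign 14 (.const 0) (.mul (.mul (.mul (.var 7) (.var 7)) (.var 7)) (.var 7)))
      (.seq (.assign 8 (.const 0) (.mul (.var 14) (.var 7)))
        (.seq (.assign 3 (.const 0) (.const 1))
          (.seq (.assign 11 (.const 0) (.const 1))
            (.seq (.assign 12 (.const 0) (.const 1)) (.assign 13 (.const 0) (.const 1)))))))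

/-- Compute the size parameter and the thresholds. -/
def setup : Program :=
  .seq initProgram (.seq (forLoop 9 (.var 14) thresholdBody) (forLoop 9 (.var 8) powerBody))

/-- A bound for the running time of `setup`. -/
def setupTime (V W b : ℕ) : ℕ :=
  initProgram.factor * (b + 1) +
    ((V + 1) * (thresholdBody.factor * (b + 1) + forFactor (.var 14) * (b + 1)) +
    (W + 1) * (powerBody.factor * (b + 1) + forFactor (.var 8) * (b + 1)) + 1) + 1

/-- There is no exponentiation, so the powers come from V multiplications by 16 = 2⁴ and W
multiplications by 2048 = 2¹¹ and 262144 = 2¹⁸. Cell 0 of array 11 is the threshold for f, that of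
12 the threshold for the `p i`, that of 13 the common denominator; array 3 holds the acceptance
flag. -/
theorem setup_spec {s : State} {b d L V W : ℕ} (hV : V = (n + d + L + 1) ^ 4)
    (hW : W = (n + d + L + 1) ^ 5)
    (hWb : 18 * W + 1 ≤ b) (hb : Bdd b s.mem)
    (h0 : s.mem 0 0 = n) (h1 : s.mem 0 1 = d) (h2 : s.mem 0 2 = L) :
    Triple F setup s (setupTime V W b) fun s' => Bdd b s'.mem ∧ s'.guesses = s.guesses ∧
      s'.mem 3 0 = 1 ∧ s'.mem 8 0 = W ∧ s'.mem 11 0 = 2 ^ (4 * V) ∧ s'.mem 12 0 = 2 ^ (11 * W) ∧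
      s'.mem 13 0 = 2 ^ (18 * W) := by
  have hNW : n + d + L + 1 ≤ W := hW ▸ Nat.le_self_pow (by norm_num) _
  have hVW : V ≤ W := by
    rw [hV, hW]; exact Nat.pow_le_pow_right (by omega) (by norm_num)
  have hb1 : bitLen 1 ≤ b := by rw [bitLen_one]; omega
  have hN : bitLen ((n : ℤ) + d + L + 1) ≤ b := by
    have := bitLen_natCast_le_of_le (j := n + d + L + 1) (k := b) (by omega)
    simpa using this
  have hWb' : bitLen (W : ℤ) ≤ b := bitLen_natCast_le_of_le (by omega)
  have hVb' : bitLen (V : ℤ) ≤ b := bitLen_natCast_le_of_le (by omega)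
  have eV : ((n : ℤ) + d + L + 1) * ((n : ℤ) + d + L + 1) * ((n : ℤ) + d + L + 1) *
      ((n : ℤ) + d + L + 1) = V := by rw [hV]; push_cast; ring
  have eW : (V : ℤ) * ((n : ℤ) + d + L + 1) = W := by rw [hV, hW]; push_cast; ring
  refine Triple.seq (Q := fun s' => Bdd b s'.mem ∧ s'.guesses = s.guesses ∧
      s'.mem 3 0 = 1 ∧ s'.mem 8 0 = W ∧ s'.mem 14 0 = V ∧ s'.mem 11 0 = 1 ∧ s'.mem 12 0 = 1 ∧
      s'.mem 13 0 = 1) (Triple.straight rfl hb ?_)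
    fun s₁ _ ⟨hb₁, hg, h3, h8, h14, h11, h12, h13⟩ =>
    Triple.seq (Triple.forLoop (M := V) (b := b) (τ := thresholdBody.factor * (b + 1))
      (Inv := fun k t => t.guesses = s.guesses ∧ t.mem 11 0 = 16 ^ k) (by decide) ?_ hVb' hb₁ ?_ ?_)
    fun s₂ f₂ ⟨_, hb₂, hg₂, i11⟩ =>
    (Triple.forLoop (M := W) (b := b) (τ := powerBody.factor * (b + 1))
      (Inv := fun k t => t.guesses = s.guesses ∧ t.mem 12 0 = 2048 ^ k ∧
        t.mem 13 0 = 262144 ^ k) (by decide) ?_ hWb' hb₂ ?_ ?_).weaken le_rfl ?_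
  · simp only [initProgram, Program.run, Expr.eval, Memory.write_apply, h0, h1, h2]
    simp only [false_and, if_false, if_true, and_self, Nat.reduceEqDiff, eV, eW]
    exact ⟨(((((((hb.write hN _ _).write hVb' _ _).write hWb' _ _).write hb1 _ _).write hb1
      _ _).write hb1 _ _).write hb1 _ _), by simp⟩
  · intro t ht
    simp [Expr.eval, ht 14 (by decide) (by decide), h14]
  · simp [Memory.write_apply, hg, h11]
  · intro k hk t _ hk' hbt ⟨hg, i11⟩
    refine Triple.straight rfl hbt ?_
    have p11 : bitLen (16 * 16 ^ k) ≤ b := by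
      rw [show (16 * 16 ^ k : ℤ) = 2 ^ (4 * (k + 1)) by rw [pow_mul]; ring]
      exact bitLen_two_pow_le (by omega)
    simp only [thresholdBody, Program.run, Expr.eval, Memory.write_apply, i11, hg]
    exact ⟨hbt.write p11 11 0, by simp [pow_succ, mul_comm]⟩
  · intro t ht
    simp [Expr.eval, ht 8 (by decide) (by decide), f₂ 8 (by decide), h8]
  · simp [Memory.write_apply, hg₂, f₂ 12 (by decide), f₂ 13 (by decide), h12, h13]
  · intro k hk t _ hk' hbt ⟨hg, i12, i13⟩
    refine Triple.straight rfl hbt ?_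
    have p12 : bitLen (2048 * 2048 ^ k) ≤ b := by
      rw [show (2048 * 2048 ^ k : ℤ) = 2 ^ (11 * (k + 1)) by rw [pow_mul]; ring]
      exact bitLen_two_pow_le (by omega)
    have p13 : bitLen (262144 * 262144 ^ k) ≤ b := by
      rw [show (262144 * 262144 ^ k : ℤ) = 2 ^ (18 * (k + 1)) by rw [pow_mul]; ring]
      exact bitLen_two_pow_le (by omega)
    simp only [powerBody, Program.run, Expr.eval, Memory.write_apply, i12, i13, hg]
    refine ⟨?_, ?_⟩
    · simpa [i13, Memory.write_apply] using (hbt.write p12 12 0).write p13 13 0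
    · simp [pow_succ, mul_comm]
  · intro t f₃ ⟨_, hbt, hg, i12, i13⟩
    refine ⟨hbt, hg, ?_, ?_, ?_, ?_, ?_⟩
    · rw [f₃ 3 (by decide), f₂ 3 (by decide), h3]
    · rw [f₃ 8 (by decide), f₂ 8 (by decide), h8]
    · rw [f₃ 11 (by decide), i11, pow_mul]; norm_num
    · rw [i12, pow_mul]; norm_num
    · rw [i13, pow_mul]; norm_num

/-! ### Guessing -/

/-- The `t`-th guessed digit. -/
def guessDigit (g : ℕ → Bool) (t : ℕ) : ℤ :=
  (if g (2 * t) then 1 else 0) - (if g (2 * t + 1) then 1 else 0)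

/-- The value of the first `r` digits of the `j`-th block of `w` guessed digits. -/
def guessVal (g : ℕ → Bool) (w j : ℕ) : ℕ → ℤ
  | 0 => 0
  | r + 1 => 2 * guessVal g w j r + guessDigit g (j * w + r)

theorem abs_guessVal_lt (g : ℕ → Bool) (w j r : ℕ) : |guessVal g w j r| < 2 ^ r := by
  induction r with
  | zero => simp [guessVal]
  | succ r ih =>
    have h : |guessDigit g (j * w + r)| ≤ 1 := by
      unfold guessDigit; split_ifs <;> simp
    rw [guessVal, abs_lt] at *
    rw [abs_le] at h
    constructor <;> rw [pow_succ] <;> omega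

/-- Signed binary expansion. The conclusion is phrased for any sequence obeying the doubling
recursion, so that the partial values of `guessVal` can be inserted directly. -/
theorem exists_digits (r : ℕ) : ∀ z : ℤ, |z| < 2 ^ r →
    ∃ δ : ℕ → ℤ, (∀ t, δ t = -1 ∨ δ t = 0 ∨ δ t = 1) ∧
      ∀ v : ℕ → ℤ, v 0 = 0 → (∀ t < r, v (t + 1) = 2 * v t + δ t) → v r = z := by
  induction r with
  | zero =>
    intro z hz
    have : z = 0 := by simpa using hz
    exact ⟨fun _ => 0, by simp, fun v hv _ => by rw [hv, this]⟩
  | succ r ih =>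
    intro z hz
    obtain ⟨y, hy, hyr⟩ : ∃ y : ℤ, (z - 2 * y = -1 ∨ z - 2 * y = 0 ∨ z - 2 * y = 1) ∧
        |y| < 2 ^ r := by
      rw [abs_lt, pow_succ] at hz
      rcases le_total 0 z with h | h
      -- Halving must round towards zero for both signs: the floor would send -1 to -1 and never
      -- terminate at 0.
      · exact ⟨z / 2, by omega, abs_lt.2 (by omega)⟩
      · exact ⟨-(-z / 2), by omega, abs_lt.2 (by omega)⟩
    obtain ⟨δ, hδ, h⟩ := ih y hyr
    refine ⟨fun t => if t = r then z - 2 * y else δ t, fun t => ?_, fun v hv hs => ?_⟩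
    · dsimp only
      split_ifs
      · exact hy
      · exact hδ t
    · have := h v hv fun t ht => by
        rw [hs t (by omega)]; dsimp only; rw [if_neg (by omega)]
      rw [hs r (by omega)]
      dsimp only
      rw [if_pos rfl, this]
      ring

/-- The blocks of `w` digits are disjoint pieces of the guess stream, so all coordinates can be
prescribed independently. A digit 1 sets its even bit, a digit -1 its odd bit. -/
theorem exists_guessVal_eq {w : ℕ} (hw : 0 < w) (z : ℕ → ℤ) (hz : ∀ j, |z j| < 2 ^ w) :
    ∃ g : ℕ → Bool, ∀ j, guessVal g w j w = z j := by
  choose δ hδ h using fun j => exists_digits w (z j) (hz j)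
  let e : ℕ → ℤ := fun t => δ (t / w) (t % w)
  refine ⟨fun k => if k % 2 = 0 then e (k / 2) = 1 else e (k / 2) = -1, fun j => ?_⟩
  refine h j (fun r => guessVal _ w j r) rfl fun t ht => ?_
  have hd : (j * w + t) / w = j := by
    rw [mul_comm, Nat.mul_add_div hw, Nat.div_eq_of_lt ht, add_zero]
  have hm : (j * w + t) % w = t := by
    rw [mul_comm, Nat.mul_add_mod, Nat.mod_eq_of_lt ht]
  have he : e (j * w + t) = δ j t := by simp only [e, hd, hm]
  simp only [guessVal, guessDigit, add_right_inj]
  have h1 : (2 * (j * w + t)) / 2 = j * w + t := by omega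
  have h2 : (2 * (j * w + t) + 1) / 2 = j * w + t := by omega
  have h3 : (2 * (j * w + t) + 1) % 2 = 1 := by omega
  simp only [Nat.mul_mod_right, h1, h2, h3, he]
  rcases hδ j t with h | h | h <;> simp [h]

/-- Append a guessed digit. -/
def guessBody : Program :=
  .seq (.guess 5 (.const 0)) (.seq (.guess 6 (.const 0))
    (.assign 4 (.div (.var 9) (.mul (.const 22) (.var 8)))
      (.add (.mul (.const 2) (.cell 4 (.div (.var 9) (.mul (.const 22) (.var 8)))))
        (.sub (.var 5) (.var 6)))))

/-- The number of guessed digits. -/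
def guessCount : Expr := .mul (.mul (.const 2) (.cell 0 (.const 0))) (.mul (.const 22) (.var 8))

/-- Guess the coordinates. -/
def guessPhase : Program := forLoop 9 guessCount guessBody

/-- A factor for the running time of `guessBody`. -/
def guessFactor : ℕ :=
  1000 + (Expr.div (.var 9) (.mul (.const 22) (.var 8))).factor +
    (Expr.add (.mul (.const 2) (.cell 4 (.div (.var 9) (.mul (.const 22) (.var 8)))))
        (.sub (.var 5) (.var 6))).factor

/-- A bound for the running time of `guessPhase`. -/
def guessTime (n W b : ℕ) : ℕ :=
  (2 * n * (22 * W) + 1) * (guessFactor * (b + 1) + forFactor guessCount * (b + 1))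

theorem guessPhase_spec {s : State} {b W : ℕ} (hW : 0 < W) (hWb : 2 * n * (22 * W) ≤ b)
    (hWb' : 22 * W ≤ b) (hb : Bdd b s.mem) (h0 : s.mem 0 0 = n) (h8 : s.mem 8 0 = W)
    (h4 : ∀ j : ℕ, s.mem 4 j = 0) :
    Triple F guessPhase s (guessTime n W b) fun s' => Bdd b s'.mem ∧
      ∀ j < 2 * n, s'.mem 4 (j : ℕ) = guessVal s.guesses (22 * W) j (22 * W) := by
  have hw : 0 < 22 * W := by omega
  have hb1 : ∀ a : Bool, bitLen (if a then 1 else 0) ≤ b := by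
    intro a; cases a <;> simp; omega
  refine (Triple.forLoop (M := 2 * n * (22 * W)) (b := b) (τ := guessFactor * (b + 1))
    -- After `k` rounds, block `j` has received min(22W, k - 22Wj) digits: truncated subtraction
    -- gives 0 for blocks not yet begun, the minimum caps the finished ones.
    (Inv := fun k t => (t.guesses = fun j => s.guesses (2 * k + j)) ∧
      ∀ j : ℕ, t.mem 4 j = guessVal s.guesses (22 * W) j (min (22 * W) (k - j * (22 * W))))
      (by decide) ?_ (bitLen_natCast_le_of_le hWb) hb ?_ ?_).weaken le_rfl ?_
  · intro t ht
    simp [guessCount, Expr.eval, ht 8 (by decide) (by decide), ht 0 (by decide) (by decide), h8,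
      h0]
  · refine ⟨by simp, fun j => ?_⟩
    simp [Memory.write_apply, h4, guessVal]
  · intro k hk t ht hk' hbt ⟨hg, hI⟩
    have h8' : t.mem 8 0 = W := by rw [ht 8 (by decide) (by decide), h8]
    have g0 := hb1 (t.guesses 0)
    have g1 := hb1 (t.guesses 1)
    refine Triple.weaken (T := 2 * (b + 1) + (2 * (b + 1) + _ * (b + 1) + 1) + 1)
      (Triple.seq (Triple.guess hbt ?_) (Q := fun t' =>
        t'.mem = t.mem.write 5 0 (if t.guesses 0 then 1 else 0) ∧
        t'.guesses = fun j => t.guesses (j + 1)) fun t' _ ht' => Triple.seq (Triple.guess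
        (Q := fun t' => t'.mem = (t.mem.write 5 0 (if t.guesses 0 then 1 else 0)).write 6 0
          (if t.guesses 1 then 1 else 0) ∧ t'.guesses = fun j => t.guesses (j + 2))
        (b := b) ?_ ?_) fun t'' _ ht'' => Triple.assign (b := b) ?_ ?_)
        ?_ (fun _ _ h => h)
    · exact ⟨rfl, rfl⟩
    · rw [ht'.1]; exact hbt.write g0 _ _
    · simp [ht'.1, ht'.2, Expr.eval]
    · rw [ht''.1]; exact (hbt.write g0 _ _).write g1 _ _
    · have hdiv : ((k : ℤ) / (22 * W)) = ((k / (22 * W) : ℕ) : ℤ) := by push_cast; rfl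
      have hq : k / (22 * W) * (22 * W) ≤ k := Nat.div_mul_le_self _ _
      have hq' : k < k / (22 * W) * (22 * W) + 22 * W := by
        have := Nat.lt_div_mul_add hw (a := k); omega
      set q := k / (22 * W) with hqdef
      have hdig : guessDigit s.guesses k = (if t.guesses 0 then 1 else 0) -
          (if t.guesses 1 then 1 else 0) := by
        simp [guessDigit, hg]
      have hval : 2 * t.mem 4 q + ((if t.guesses 0 then 1 else 0) -
          (if t.guesses 1 then 1 else 0)) =
          guessVal s.guesses (22 * W) q (min (22 * W) (k + 1 - q * (22 * W))) := by
        rw [hI, min_eq_right (by omega), min_eq_right (by omega), ← hdig,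
          show k + 1 - q * (22 * W) = (k - q * (22 * W)) + 1 by omega, guessVal]
        congr 2
        exact (Nat.add_sub_cancel' hq).symm
      simp only [ht''.1, ht''.2, Expr.eval, Memory.write_apply, hk', h8']
      simp only [false_and, if_false, true_and, if_true,
        and_self, Nat.reduceEqDiff, hdiv, hval]
      refine ⟨((hbt.write g0 _ _).write g1 _ _).write ?_ _ _, ?_, fun j => ?_⟩
      · exact bitLen_le.2 ((abs_guessVal_lt _ _ _ _).trans_le
          (pow_le_pow_right₀ (by norm_num) ((min_le_left _ _).trans hWb')))
      · rw [hg]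
        funext j
        exact congrArg s.guesses (by ring)
      · by_cases hjq : j = q
        · subst hjq; simp
        · rw [if_neg (by simpa using hjq), hI]
          rcases lt_or_gt_of_ne hjq with h | h
          · have : (j + 1) * (22 * W) ≤ q * (22 * W) := Nat.mul_le_mul_right _ h
            rw [add_mul, one_mul] at this
            congr 1
            omega
          · have : (q + 1) * (22 * W) ≤ j * (22 * W) := Nat.mul_le_mul_right _ h
            rw [add_mul, one_mul] at this
            congr 1
            omega
    · simp only [guessFactor, Expr.factor, Expr.growth]
      generalize bitLen 0 = e0, bitLen 1 = e1, bitLen 2 = e2, bitLen 22 = e22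
      nlinarith
  · intro t ht ⟨_, hbt, _, hI⟩
    refine ⟨hbt, fun j hj => ?_⟩
    rw [hI]
    have : (j + 1) * (22 * W) ≤ 2 * n * (22 * W) := Nat.mul_le_mul_right _ hj
    rw [add_mul, one_mul] at this
    congr 1
    omega

end BlackBoxMachine

namespace BlackBoxMachine

variable {n : ℕ} {F : (Fin n → ℚ) → ℚ}

/-! ### Evaluation of univariate polynomials -/

/-- Horner's scheme, with the coefficients in descending order. -/
noncomputable def hornerVal (z : ℂ) (c : ℕ → ℂ) : ℕ → ℂ
  | 0 => 0
  | j + 1 => hornerVal z c j * z + c j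

/-- A complex value is stored as (R + iI)/E with integers. Comparing squares avoids roots and makes
the sign of E irrelevant. -/
theorem zero_lt_sq_sub_iff {R I E K : ℤ} {H : ℂ} (h : (R : ℂ) + I * Complex.I = E * H)
    (hE : E ≠ 0) (hK : 0 < K) : 0 < E * E - (R * R + I * I) * (K * K) ↔ ‖H‖ * K < 1 := by
  have hn : (R : ℝ) * R + I * I = E * E * (‖H‖ * ‖H‖) := by
    have h2 := congrArg Complex.normSq h
    rw [Complex.normSq_mul, Complex.normSq_eq_norm_sq H, Complex.normSq_apply,
      Complex.normSq_apply] at h2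
    simp at h2
    linarith
  have hE' : (0 : ℝ) < (E : ℝ) * E := by
    exact mul_self_pos.2 (by exact_mod_cast hE)
  have hK' : (0 : ℝ) < K := by exact_mod_cast hK
  have hcast : 0 < E * E - (R * R + I * I) * (K * K) ↔
      (0 : ℝ) < (E : ℝ) * E * (1 - (‖H‖ * K) * (‖H‖ * K)) := by
    rw [show (E : ℝ) * E * (1 - (‖H‖ * K) * (‖H‖ * K)) =
      (E : ℝ) * E - (E * E * (‖H‖ * ‖H‖)) * (K * K) by ring, ← hn]
    exact_mod_cast Iff.rfl
  have hnn : 0 ≤ ‖H‖ * K := by positivity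
  rw [hcast, mul_pos_iff_of_pos_left hE']
  constructor
  · intro h; nlinarith
  · intro h; nlinarith

/-- The address of the current coefficient. -/
def coeffIndex : Expr :=
  .add (.mul (.var 9) (.add (.cell 0 (.const 1)) (.const 1))) (.sub (.cell 0 (.const 1)) (.var 10))

/-- One step of Horner's scheme. -/
def hornerBody : Program :=
  .seq (.assign 18 (.const 0) (.add (.mul (.sub (.mul (.var 15) (.cell 4 (.var 9)))
      (.mul (.var 16) (.cell 4 (.add (.cell 0 (.const 0)) (.var 9))))) (.cell 2 coeffIndex))
      (.mul (.mul (.cell 1 coeffIndex) (.var 17)) (.var 13))))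
    (.seq (.assign 16 (.const 0) (.mul (.add (.mul (.var 15) (.cell 4 (.add (.cell 0 (.const 0))
      (.var 9)))) (.mul (.var 16) (.cell 4 (.var 9)))) (.cell 2 coeffIndex)))
      (.seq (.assign 15 (.const 0) (.var 18))
        (.assign 17 (.const 0) (.mul (.mul (.var 17) (.var 13)) (.cell 2 coeffIndex)))))

/-- The expression `d + 1`. -/
def succDegree : Expr := .add (.cell 0 (.const 1)) (.const 1)

/-- A bound for the running time of Horner's scheme. -/
def hornerTime (d b : ℕ) : ℕ :=
  (d + 1 + 1) * (hornerBody.factor * (b + 1) + forFactor succDegree * (b + 1))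

/-- The partial Horner value is kept as a fraction whose denominator gains the factor q·δ in each
step, without reduction. A step adds at most 2β + 2 ≤ 4β bits, so the length stays linear in the
number of steps. -/
theorem horner_spec {s : State} {b d k β : ℕ} {a c q : ℤ} {ν δ : ℕ → ℤ} (hβ : 1 ≤ β)
    (hβb : 1 + 4 * β * (d + 1) ≤ b) (hb : Bdd b s.mem)
    (hn : s.mem 0 0 = n) (hd : s.mem 0 1 = d) (hk : s.mem 9 0 = k) (ha : s.mem 4 k = a)
    (hc : s.mem 4 (n + k) = c) (hq : s.mem 13 0 = q) (hq0 : q ≠ 0)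
    (hν : ∀ j ≤ d, s.mem 1 (k * (d + 1) + (d - j)) = ν j)
    (hδ : ∀ j ≤ d, s.mem 2 (k * (d + 1) + (d - j)) = δ j) (hδ0 : ∀ j, δ j ≠ 0)
    (hab : bitLen a ≤ β) (hcb : bitLen c ≤ β) (hqb : bitLen q ≤ β) (hνb : ∀ j, bitLen (ν j) ≤ β)
    (hδb : ∀ j, bitLen (δ j) ≤ β)
    (hR : s.mem 15 0 = 0) (hI : s.mem 16 0 = 0) (hE : s.mem 17 0 = 1) :
    Triple F (forLoop 10 succDegree hornerBody) s (hornerTime d b) fun s' =>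
      Bdd b s'.mem ∧ s'.mem 17 0 ≠ 0 ∧ (s'.mem 15 0 : ℂ) + s'.mem 16 0 * Complex.I =
        s'.mem 17 0 * hornerVal ((a + c * Complex.I) / q) (fun j => ν j / δ j) (d + 1) := by
  refine (Triple.forLoop (M := d + 1) (b := b) (τ := hornerBody.factor * (b + 1))
    (Inv := fun j t => t.mem 17 0 ≠ 0 ∧ (t.mem 15 0 : ℂ) + t.mem 16 0 * Complex.I =
        t.mem 17 0 * hornerVal ((a + c * Complex.I) / q) (fun j => ν j / δ j) j ∧
        bitLen (t.mem 15 0) ≤ 1 + 4 * β * j ∧ bitLen (t.mem 16 0) ≤ 1 + 4 * β * j ∧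
        bitLen (t.mem 17 0) ≤ 1 + 4 * β * j) (by decide) ?_
        (bitLen_natCast_le_of_le (by nlinarith)) hb ?_ ?_).weaken le_rfl ?_
  · intro t ht
    simp [succDegree, Expr.eval, ht 0 (by decide) (by decide), hd]
  · simp [Memory.write_apply, hR, hI, hE, hornerVal]
  · intro j hj t ht hj' hbt ⟨i17, hH, b15, b16, b17⟩
    refine Triple.straight rfl hbt ?_
    have t0 := ht 0 (by decide) (by decide)
    have t1 := ht 1 (by decide) (by decide)
    have t2 := ht 2 (by decide) (by decide)
    have t4 := ht 4 (by decide) (by decide)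
    have t9 := ht 9 (by decide) (by decide)
    have t13 := ht 13 (by decide) (by decide)
    have hν' := hν j (by omega)
    have hδ' := hδ j (by omega)
    have hjb : 1 + 4 * β * (j + 1) ≤ 1 + 4 * β * (d + 1) := by gcongr; omega
    have hT : bitLen ((t.mem 15 0 * a - t.mem 16 0 * c) * δ j + ν j * t.mem 17 0 * q) ≤
        1 + 4 * β * (j + 1) := by
      refine (bitLen_add_le (k := 1 + 4 * β * j + β + 1 + β)
        (bitLen_mul_le (bitLen_sub_le (bitLen_mul_le b15 hab) (bitLen_mul_le b16 hcb)) (hδb j))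
        ((bitLen_mul_le (bitLen_mul_le (hνb j) b17) hqb).trans (by omega))).trans ?_
      nlinarith
    have hI' : bitLen ((t.mem 15 0 * c + t.mem 16 0 * a) * δ j) ≤ 1 + 4 * β * (j + 1) := by
      refine (bitLen_mul_le (bitLen_add_le (bitLen_mul_le b15 hcb) (bitLen_mul_le b16 hab))
        (hδb j)).trans ?_
      nlinarith
    have hE' : bitLen (t.mem 17 0 * q * δ j) ≤ 1 + 4 * β * (j + 1) := by
      refine (bitLen_mul_le (bitLen_mul_le b17 hqb) (hδb j)).trans ?_
      nlinarith
    simp only [hornerBody, coeffIndex, Program.run, Expr.eval, Memory.write_apply, t0, t1, t2, t4,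
      t9, t13, hn, hd, hk, ha, hc, hq, hν', hδ', hj']
    simp only [Nat.reduceEqDiff, false_and, if_false, and_self, if_true, ha, hc, hδ']
    refine ⟨(((hbt.write (by omega) _ _).write (by omega) _ _).write (by omega) _ _).write
      (by omega) _ _, mul_ne_zero (mul_ne_zero i17 hq0) (hδ0 j), ?_, hT, hI', hE'⟩
    have hqc : (q : ℂ) ≠ 0 := by exact_mod_cast hq0
    have hδc : (δ j : ℂ) ≠ 0 := by exact_mod_cast hδ0 j
    rw [hornerVal]
    push_cast
    field_simp
    have hII := Complex.I_mul_I
    linear_combination (a + c * Complex.I) * (δ j) * hH - (t.mem 16 0) * c * (δ j) * hII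
  · intro t ht ⟨_, hbt, h17, hH, _⟩
    exact ⟨hbt, h17, hH⟩

/-- Prepare Horner's scheme. -/
def hornerInit : Program :=
  .seq (.assign 15 (.const 0) (.const 0)) (.seq (.assign 16 (.const 0) (.const 0))
    (.assign 17 (.const 0) (.const 1)))

/-- Reject if the value is not small. -/
def hornerCheck : Program :=
  .ite (.sub (.mul (.var 17) (.var 17)) (.mul (.add (.mul (.var 15) (.var 15))
    (.mul (.var 16) (.var 16))) (.mul (.var 12) (.var 12)))) .skip
    (.assign 3 (.const 0) (.const 0))

/-- Check that the guessed coordinates are close to roots. -/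
def rootPhase : Program :=
  forLoop 9 (.cell 0 (.const 0))
    (.seq hornerInit (.seq (forLoop 10 succDegree hornerBody) hornerCheck))

/-- A bound for the running time of `rootPhase`. -/
def rootTime (n d b : ℕ) : ℕ :=
  (n + 1) * ((hornerInit.factor * (b + 1) + (hornerTime d b + hornerCheck.factor * (b + 1) + 1)
    + 1) + forFactor (.cell 0 (.const 0)) * (b + 1))

/-- The flag can only be lowered, so after the loop it records the conjunction of the tests of all
coordinates. -/
theorem rootPhase_spec {s : State} {b d β : ℕ} {x : ℕ → ℤ} {q K : ℤ} {ν δ : ℕ → ℕ → ℤ}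
    (hβ : 1 ≤ β) (hβb : 1 + 4 * β * (d + 1) ≤ b) (hnb : n ≤ b) (hb : Bdd b s.mem)
    (hn : s.mem 0 0 = n) (hd : s.mem 0 1 = d)
    (hx : ∀ k < 2 * n, s.mem 4 (k : ℕ) = x k)
    (hq : s.mem 13 0 = q) (hq0 : q ≠ 0) (hK : s.mem 12 0 = K) (hK0 : 0 < K)
    (hν : ∀ k < n, ∀ j ≤ d, s.mem 1 (k * (d + 1) + (d - j)) = ν k j)
    (hδ : ∀ k < n, ∀ j ≤ d, s.mem 2 (k * (d + 1) + (d - j)) = δ k j)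
    (hδ0 : ∀ k j, δ k j ≠ 0)
    (hxb : ∀ k, bitLen (x k) ≤ β) (hqb : bitLen q ≤ β)
    (hνb : ∀ k j, bitLen (ν k j) ≤ β) (hδb : ∀ k j, bitLen (δ k j) ≤ β)
    (hok : s.mem 3 0 = 1) :
    Triple F rootPhase s (rootTime n d b) fun s' => Bdd b s'.mem ∧
      (s'.mem 3 0 = 1 ↔ ∀ k < n, ‖hornerVal ((x k + x (n + k) * Complex.I) / q)
        (fun j => ν k j / δ k j) (d + 1)‖ * K < 1) := by
  refine (Triple.forLoop (M := n) (b := b) (τ := _)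
    (Inv := fun m t => (t.mem 3 0 = 1 ↔ ∀ k < m,
      ‖hornerVal ((x k + x (n + k) * Complex.I) / q)
        (fun j => ν k j / δ k j) (d + 1)‖ * K < 1)) (by decide) ?_
        (bitLen_natCast_le_of_le hnb) hb ?_ ?_).weaken le_rfl ?_
  · intro t ht
    simp [Expr.eval, ht 0 (by decide) (by decide), hn]
  · simp [Memory.write_apply, hok]
  · intro k hk t ht hk' hbt hI
    have t0 := ht 0 (by decide) (by decide)
    have t1 := ht 1 (by decide) (by decide)
    have t2 := ht 2 (by decide) (by decide)
    have t4 := ht 4 (by decide) (by decide)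
    have t12 := ht 12 (by decide) (by decide)
    have t13 := ht 13 (by decide) (by decide)
    have hb1 : bitLen 1 ≤ b := by rw [bitLen_one]; omega
    refine Triple.seq (Q := fun t' => Bdd b t'.mem ∧ t'.mem 15 0 = 0 ∧ t'.mem 16 0 = 0 ∧
      t'.mem 17 0 = 1) (Triple.straight rfl hbt ?_) fun t' ht' ⟨hbt', h15, h16, h17⟩ =>
      Triple.seq (Q := fun s' => Bdd b s'.mem ∧ s'.mem 17 0 ≠ 0 ∧
        (s'.mem 15 0 : ℂ) + s'.mem 16 0 * Complex.I = s'.mem 17 0 *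
          hornerVal ((x k + x (n + k) * Complex.I) / q) (fun j => ν k j / δ k j) (d + 1))
        (horner_spec (k := k) (β := β) hβ hβb hbt' ?_ ?_ ?_ ?_ ?_ ?_ hq0 ?_ ?_ (hδ0 k)
          (hxb _) (hxb _) hqb (hνb k) (hδb k) h15 h16 h17)
        fun t'' ht'' ⟨hbt'', h17', hH⟩ => Triple.straight rfl hbt'' ?_
    · simp only [hornerInit, Program.run, Expr.eval]
      refine ⟨((hbt.write (by simp) _ _).write (by simp) _ _).write hb1 _ _, ?_⟩
      simp [Memory.write_apply]
    · rw [ht' 0 (by decide), t0, hn]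
    · rw [ht' 0 (by decide), t0, hd]
    · rw [ht' 9 (by decide), hk']
    · rw [ht' 4 (by decide), t4, hx k (by omega)]
    · rw [ht' 4 (by decide), t4]; exact_mod_cast hx (n + k) (by omega)
    · rw [ht' 13 (by decide), t13, hq]
    · intro j hj; rw [ht' 1 (by decide), t1, hν k hk j hj]
    · intro j hj; rw [ht' 2 (by decide), t2, hδ k hk j hj]
    · have h12 : t''.mem 12 0 = K := by
        rw [ht'' 12 (by decide), ht' 12 (by decide), t12, hK]
      have h3 : t''.mem 3 0 = t.mem 3 0 := by
        rw [ht'' 3 (by decide), ht' 3 (by decide)]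
      have hiff := zero_lt_sq_sub_iff hH h17' hK0
      simp only [hornerCheck, Program.run, Expr.eval, h12, hiff]
      split_ifs with hc
      · refine ⟨hbt'', ?_⟩
        simp only [Memory.write_apply, Nat.reduceEqDiff, false_and, if_false, h3, hI]
        refine ⟨fun h i hi => ?_, fun h i hi => h i (by omega)⟩
        rcases Nat.lt_succ_iff_lt_or_eq.1 hi with hi | rfl
        · exact h i hi
        · exact hc
      · refine ⟨hbt''.write (by simp) _ _, ?_⟩
        simp only [Memory.write_apply, Nat.reduceEqDiff, false_and, if_false, and_self, if_true]
        exact ⟨fun h => by simp at h, fun h => absurd (h k (by omega)) hc⟩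
  · intro t ht ⟨_, hbt, hI⟩
    exact ⟨hbt, hI⟩

end BlackBoxMachine

namespace BlackBoxMachine

open Finset

variable {n : ℕ} {F : (Fin n → ℚ) → ℚ}

/-! ### Interpolation -/

/-- The numerator at `I` of the `k`-th Lagrange polynomial, up to the node `j`. -/
noncomputable def lagrangeNum (k j : ℕ) : ℂ :=
  ∏ l ∈ range j, if l = k then 1 else Complex.I - l

/-- The denominator of the `k`-th Lagrange polynomial, up to the node `j`. -/
def lagrangeDen (k j : ℕ) : ℤ := ∏ l ∈ range j, if l = k then 1 else (k : ℤ) - l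

theorem lagrangeDen_ne_zero (k j : ℕ) : lagrangeDen k j ≠ 0 := by
  refine prod_ne_zero_iff.2 fun l _ => ?_
  split_ifs with h
  · exact one_ne_zero
  · exact sub_ne_zero.2 (by exact_mod_cast Ne.symm h)

/-- Start the computation of an interpolation weight. -/
def weightInit : Program :=
  .seq (.assign 23 (.const 0) (.const 1)) (.seq (.assign 24 (.const 0) (.const 0))
    (.assign 25 (.const 0) (.const 1)))

/-- Take another node into account. -/
def weightBody : Program :=
  .ite (.mul (.sub (.var 9) (.var 10)) (.sub (.var 9) (.var 10)))
    (.seq (.assign 18 (.const 0) (.sub (.sub (.const 0) (.mul (.var 23) (.var 10))) (.var 24)))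
      (.seq (.assign 24 (.const 0) (.sub (.var 23) (.mul (.var 24) (.var 10))))
        (.seq (.assign 23 (.const 0) (.var 18))
          (.assign 25 (.const 0) (.mul (.var 25) (.sub (.var 9) (.var 10)))))))
    .skip

/-- A bound for the running time of the computation of a weight. -/
def weightTime (d b : ℕ) : ℕ :=
  (d + 1 + 1) * (weightBody.factor * (b + 1) + forFactor succDegree * (b + 1))

/-- Numerator and denominator of the Lagrange weight are products of factors i - l and k - l, hence
a Gaussian integer and an integer, each step costing at most β + 1 ≤ 2β further bits. As branching
only tests positivity, the node l = k is skipped by testing (k - l)². -/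
theorem weight_spec {s : State} {b d k β : ℕ} (hβ : 1 ≤ β) (hdβ : d ≤ β) (hkd : k ≤ d)
    (hβb : 1 + 2 * β * (d + 1) ≤ b) (hb : Bdd b s.mem)
    (hd : s.mem 0 1 = d) (hk : s.mem 9 0 = k)
    (h23 : s.mem 23 0 = 1) (h24 : s.mem 24 0 = 0) (h25 : s.mem 25 0 = 1) :
    Triple F (forLoop 10 succDegree weightBody) s (weightTime d b) fun s' =>
      Bdd b s'.mem ∧ (s'.mem 23 0 : ℂ) + s'.mem 24 0 * Complex.I = lagrangeNum k (d + 1) ∧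
        s'.mem 25 0 = lagrangeDen k (d + 1) ∧ bitLen (s'.mem 23 0) ≤ 1 + 2 * β * (d + 1) ∧
        bitLen (s'.mem 24 0) ≤ 1 + 2 * β * (d + 1) ∧
        bitLen (s'.mem 25 0) ≤ 1 + 2 * β * (d + 1) := by
  refine (Triple.forLoop (M := d + 1) (b := b) (τ := weightBody.factor * (b + 1))
    (Inv := fun j t => (t.mem 23 0 : ℂ) + t.mem 24 0 * Complex.I = lagrangeNum k j ∧
        t.mem 25 0 = lagrangeDen k j ∧ bitLen (t.mem 23 0) ≤ 1 + 2 * β * j ∧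
        bitLen (t.mem 24 0) ≤ 1 + 2 * β * j ∧
        bitLen (t.mem 25 0) ≤ 1 + 2 * β * j) (by decide) ?_
        (bitLen_natCast_le_of_le (by nlinarith)) hb ?_ ?_).weaken le_rfl ?_
  · intro t ht
    simp [succDegree, Expr.eval, ht 0 (by decide) (by decide), hd]
  · simp [Memory.write_apply, h23, h24, h25, lagrangeNum, lagrangeDen]
  · intro j hj t ht hj' hbt ⟨hN, hD, b23, b24, b25⟩
    refine Triple.straight rfl hbt ?_
    have t9 := ht 9 (by decide) (by decide)
    have hjb : 1 + 2 * β * (j + 1) ≤ 1 + 2 * β * (d + 1) := by gcongr; omega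
    have hlN : lagrangeNum k (j + 1) = lagrangeNum k j * if j = k then 1 else Complex.I - j := by
      rw [lagrangeNum, prod_range_succ, ← lagrangeNum]
    have hlD : lagrangeDen k (j + 1) = lagrangeDen k j * if j = k then 1 else (k : ℤ) - j := by
      rw [lagrangeDen, prod_range_succ, ← lagrangeDen]
    simp only [weightBody, Program.run, Expr.eval, t9, hk, hj']
    by_cases hjk : j = k
    · subst hjk
      simp only [sub_self, mul_zero, lt_irrefl, if_false]
      refine ⟨hbt, ?_⟩
      simp only [Memory.write_apply, Nat.reduceEqDiff, false_and, if_false, hlN, hlD, if_true,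
        mul_one]
      refine ⟨hN, hD, ?_, ?_, ?_⟩ <;> nlinarith
    · have hpos : (0 : ℤ) < (k - j) * (k - j) :=
        mul_self_pos.2 (sub_ne_zero.2 (by exact_mod_cast Ne.symm hjk))
      have hjβ : bitLen (j : ℤ) ≤ β := bitLen_natCast_le_of_le (by omega)
      have hkjβ : bitLen ((k : ℤ) - j) ≤ β := by
        refine bitLen_le_of_abs_le (z := d) ?_ (bitLen_natCast_le_of_le hdβ)
        rw [abs_le, abs_of_nonneg (by positivity)]
        omega
      rw [if_neg hjk] at hlN hlD
      have e1 : bitLen (0 - t.mem 23 0 * j - t.mem 24 0) ≤ 1 + 2 * β * (j + 1) := by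
        rw [zero_sub]
        refine (bitLen_sub_le (k := 1 + 2 * β * j + β) ?_ (by omega)).trans ?_
        · rw [bitLen_neg]; exact bitLen_mul_le b23 hjβ
        · nlinarith
      have e2 : bitLen (t.mem 23 0 - t.mem 24 0 * j) ≤ 1 + 2 * β * (j + 1) := by
        refine (bitLen_sub_le (k := 1 + 2 * β * j + β) (by omega) (bitLen_mul_le b24 hjβ)).trans ?_
        nlinarith
      have e3 : bitLen (t.mem 25 0 * (k - j)) ≤ 1 + 2 * β * (j + 1) := by
        refine (bitLen_mul_le b25 hkjβ).trans ?_
        nlinarith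
      simp only [hpos, if_true, Memory.write_apply, Nat.reduceEqDiff, false_and, if_false,
        and_self, t9, hk, hj']
      refine ⟨(((hbt.write (by omega) _ _).write (by omega) _ _).write (by omega) _ _).write
        (by omega) _ _, ?_, by rw [hlD, hD], e1, e2, e3⟩
      rw [hlN, ← hN]
      push_cast
      linear_combination -(t.mem 24 0) * Complex.I_mul_I
  · intro t ht ⟨_, hbt, hI⟩
    exact ⟨hbt, by simpa using hI⟩

/-- Write a coordinate of the next question. -/
def pointBody : Program :=
  .seq (.assign 19 (.var 10) (.add (.cell 4 (.var 10)) (.mul (.var 9) (.cell 4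
    (.add (.cell 0 (.const 0)) (.var 10)))))) (.assign 20 (.var 10) (.var 13))

/-- A bound for the running time of writing a question. -/
def pointTime (n b : ℕ) : ℕ :=
  (n + 1) * (pointBody.factor * (b + 1) + forFactor (.cell 0 (.const 0)) * (b + 1))

/-- The question is the point a + kb on the line through the real and imaginary parts; for integral
`k` it is rational with denominator `q`. -/
theorem point_spec {s : State} {b d k β : ℕ} {x : ℕ → ℤ} {q : ℤ} (hdβ : d ≤ β) (hkd : k ≤ d)
    (hβb : 2 * β + 1 ≤ b) (hnb : n ≤ b) (hb : Bdd b s.mem)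
    (hn : s.mem 0 0 = n) (hk : s.mem 9 0 = k) (hx : ∀ k < 2 * n, s.mem 4 (k : ℕ) = x k)
    (hq : s.mem 13 0 = q) (hxb : ∀ k, bitLen (x k) ≤ β) (hqb : bitLen q ≤ β) :
    Triple F (forLoop 10 (.cell 0 (.const 0)) pointBody) s (pointTime n b) fun s' =>
      Bdd b s'.mem ∧ ∀ l < n, s'.mem 19 (l : ℕ) = x l + k * x (n + l) ∧ s'.mem 20 (l : ℕ) = q := by
  refine (Triple.forLoop (M := n) (b := b) (τ := pointBody.factor * (b + 1))
    (Inv := fun j t => ∀ l < j, t.mem 19 (l : ℕ) = x l + k * x (n + l) ∧ t.mem 20 (l : ℕ) = q)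
    (by decide) ?_ (bitLen_natCast_le_of_le hnb) hb (by simp) ?_).weaken le_rfl ?_
  · intro t ht
    simp [Expr.eval, ht 0 (by decide) (by decide), hn]
  · intro j hj t ht hj' hbt hI
    refine Triple.straight rfl hbt ?_
    have t0 := ht 0 (by decide) (by decide)
    have t4 := ht 4 (by decide) (by decide)
    have t9 := ht 9 (by decide) (by decide)
    have t13 := ht 13 (by decide) (by decide)
    have hx1 := hx j (by omega)
    have hx2 : s.mem 4 ((n : ℤ) + j) = x (n + j) := by exact_mod_cast hx (n + j) (by omega)
    have e1 : bitLen (x j + k * x (n + j)) ≤ b := by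
      refine (bitLen_add_le (k := 2 * β) ((hxb j).trans (by omega)) ?_).trans hβb
      rw [two_mul]
      exact bitLen_mul_le (bitLen_natCast_le_of_le (by omega)) (hxb _)
    have e2 : bitLen q ≤ b := by omega
    simp only [pointBody, Program.run, Expr.eval, Memory.write_apply, t0, t4, t9, t13, hn, hk, hq,
      hx1, hx2, hj']
    simp only [Nat.reduceEqDiff, false_and, if_false, true_and]
    refine ⟨(hbt.write e1 _ _).write e2 _ _, fun l hl => ?_⟩
    by_cases hlj : l = j
    · subst hlj; simp
    · have := hI l (by omega)
      simpa [hlj] using this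
  · intro t ht ⟨_, hbt, hI⟩
    exact ⟨hbt, hI⟩

/-- Add a term of the interpolation formula. -/
def accumBody : Program :=
  .seq (.assign 27 (.const 0) (.add (.mul (.mul (.var 27) (.var 22)) (.var 25))
      (.mul (.mul (.var 21) (.var 23)) (.var 29))))
    (.seq (.assign 28 (.const 0) (.add (.mul (.mul (.var 28) (.var 22)) (.var 25))
      (.mul (.mul (.var 21) (.var 24)) (.var 29))))
      (.assign 29 (.const 0) (.mul (.mul (.var 29) (.var 22)) (.var 25))))

/-- Process a node. -/
def nodeBody : Program :=
  .seq weightInit (.seq (forLoop 10 succDegree weightBody)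
    (.seq (forLoop 10 (.cell 0 (.const 0)) pointBody) (.seq (.query 19 20 21 22) accumBody)))

/-- A bound for the running time of `nodeBody`. -/
def nodeTime (n d b : ℕ) : ℕ :=
  weightInit.factor * (b + 1) + (weightTime d b + (pointTime n b +
    ((n * (2 * b + 1) + 2 * b + 1) + accumBody.factor * (b + 1) + 1) + 1) + 1) + 1

/-- The `k`-th question to the black box. -/
noncomputable def nodePoint (n : ℕ) (x : ℕ → ℤ) (q : ℤ) (k : ℕ) : Fin n → ℚ :=
  fun i => ((x i + k * x (n + i) : ℤ) : ℚ) / q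

/-- The sum of the first terms of the interpolation formula. -/
noncomputable def lagrangeSum (F : (Fin n → ℚ) → ℚ) (x : ℕ → ℤ) (q : ℤ) (d k : ℕ) : ℂ :=
  ∑ m ∈ range k, (F (nodePoint n x q m) : ℂ) * (lagrangeNum m (d + 1) / lagrangeDen m (d + 1))

theorem Triple.query {x y u v : ℕ} {s : State} {b : ℕ} {Q : State → Prop} {a : Fin n → ℚ}
    (hb : Bdd b s.mem) (ha : queryPoint n s.mem x y = a) (hnum : bitLen (F a).num ≤ b)
    (hden : bitLen (F a).den ≤ b)
    (h : Q ⟨(s.mem.write u 0 (F a).num).write v 0 (F a).den, s.guesses⟩) :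
    Triple F (.query x y u v) s (n * (2 * b + 1) + 2 * b + 1) Q := by
  subst ha
  refine ⟨_, _, .query x y u v s, ?_, h⟩
  have : ∑ i : Fin n, (bitLen (s.mem x ((i : ℕ) : ℤ)) + bitLen (s.mem y ((i : ℕ) : ℤ)) + 1) ≤
      ∑ _i : Fin n, (2 * b + 1) :=
    sum_le_sum fun i _ => by have := hb x (i : ℕ); have := hb y (i : ℕ); omega
  simp only [sum_const, card_univ, Fintype.card_fin, smul_eq_mul] at this
  unfold queryCost
  omega

/-- Prepare the interpolation. -/
def interpolationInit : Program :=
  .seq (.assign 27 (.const 0) (.const 0)) (.seq (.assign 28 (.const 0) (.const 0))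
    (.assign 29 (.const 0) (.const 1)))

/-- Reject if the value is small. -/
def valueCheck : Program :=
  .ite (.sub (.mul (.var 29) (.var 29)) (.mul (.add (.mul (.var 27) (.var 27))
    (.mul (.var 28) (.var 28))) (.mul (.var 11) (.var 11))))
    (.assign 3 (.const 0) (.const 0)) .skip

/-- Compute the value at the guessed point, and reject if it is small. -/
def valuePhase : Program :=
  .seq interpolationInit (.seq (forLoop 9 succDegree nodeBody) valueCheck)

/-- A bound for the running time of `valuePhase`. -/
def valueTime (n d b : ℕ) : ℕ :=
  interpolationInit.factor * (b + 1) + ((d + 1 + 1) * (nodeTime n d b +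
    forFactor succDegree * (b + 1)) + valueCheck.factor * (b + 1) + 1) + 1

/-- The running sum has as denominator the product of all answer and weight denominators so far.
With answers of β bits and weights of ω bits, adding a fraction costs at most β + ω + 1 bits. -/
theorem nodeBody_spec {s : State} {b d k β : ℕ} {x : ℕ → ℤ} {q : ℤ} {S : ℂ}
    (hβ : 1 ≤ β) (hdβ : d ≤ β) (hnb : n ≤ b) (hkd : k ≤ d)
    (hβb : 1 + (d + 1) * (β + (1 + 2 * β * (d + 1)) + 1) ≤ b)
    (hb : Bdd b s.mem) (hn : s.mem 0 0 = n) (hd : s.mem 0 1 = d) (hk : s.mem 9 0 = k)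
    (hx : ∀ k < 2 * n, s.mem 4 (k : ℕ) = x k) (hq : s.mem 13 0 = q)
    (hxb : ∀ k, bitLen (x k) ≤ β) (hqb : bitLen q ≤ β)
    (hnum : bitLen (F (nodePoint n x q k)).num ≤ β)
    (hden : bitLen (F (nodePoint n x q k)).den ≤ β)
    (hE : s.mem 29 0 ≠ 0) (hS : (s.mem 27 0 : ℂ) + s.mem 28 0 * Complex.I = s.mem 29 0 * S)
    (hb27 : bitLen (s.mem 27 0) ≤ 1 + k * (β + (1 + 2 * β * (d + 1)) + 1))
    (hb28 : bitLen (s.mem 28 0) ≤ 1 + k * (β + (1 + 2 * β * (d + 1)) + 1))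
    (hb29 : bitLen (s.mem 29 0) ≤ 1 + k * (β + (1 + 2 * β * (d + 1)) + 1)) :
    Triple F nodeBody s (nodeTime n d b) fun s' => Bdd b s'.mem ∧ s'.mem 29 0 ≠ 0 ∧
      (s'.mem 27 0 : ℂ) + s'.mem 28 0 * Complex.I = s'.mem 29 0 * (S +
        (F (nodePoint n x q k) : ℂ) * (lagrangeNum k (d + 1) / lagrangeDen k (d + 1))) ∧
      bitLen (s'.mem 27 0) ≤ 1 + (k + 1) * (β + (1 + 2 * β * (d + 1)) + 1) ∧
      bitLen (s'.mem 28 0) ≤ 1 + (k + 1) * (β + (1 + 2 * β * (d + 1)) + 1) ∧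
      bitLen (s'.mem 29 0) ≤ 1 + (k + 1) * (β + (1 + 2 * β * (d + 1)) + 1) := by
  set ω := 1 + 2 * β * (d + 1) with hω
  have hωb : β + ω + 2 ≤ b := by nlinarith
  have h2β : 2 * β + 1 ≤ ω := by rw [hω]; nlinarith
  have hb1 : bitLen 1 ≤ b := by rw [bitLen_one]; omega
  have hkb : 1 + (k + 1) * (β + ω + 1) ≤ b := le_trans (by gcongr) hβb
  refine Triple.seq (Q := fun t => Bdd b t.mem ∧ t.mem 23 0 = 1 ∧ t.mem 24 0 = 0 ∧
    t.mem 25 0 = 1) (Triple.straight rfl hb ?_) fun t₁ f₁ ⟨hb₁, h23, h24, h25⟩ =>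
    Triple.seq (weight_spec hβ hdβ hkd (by omega) hb₁ ?_ ?_ h23 h24 h25)
    fun t₂ f₂ ⟨hb₂, hN, hD, b23, b24, b25⟩ =>
    Triple.seq (point_spec (x := x) (q := q) hdβ hkd (by omega) hnb hb₂ ?_ ?_ ?_ ?_ hxb hqb)
    fun t₃ f₃ ⟨hb₃, hpt⟩ =>
    Triple.seq (Q := fun t => t.mem = (t₃.mem.write 21 0 (F (nodePoint n x q k)).num).write 22 0
      (F (nodePoint n x q k)).den) (Triple.query hb₃ ?_ (hnum.trans (by omega))
      (hden.trans (by omega)) rfl) fun t₄ f₄ h₄ => Triple.straight (b := b) rfl ?_ ?_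
  · simp only [weightInit, Program.run, Expr.eval]
    refine ⟨((hb.write hb1 _ _).write (by simp) _ _).write hb1 _ _, ?_⟩
    simp [Memory.write_apply]
  · rw [f₁ 0 (by decide), hd]
  · rw [f₁ 9 (by decide), hk]
  · rw [f₂ 0 (by decide), f₁ 0 (by decide), hn]
  · rw [f₂ 9 (by decide), f₁ 9 (by decide), hk]
  · intro j hj; rw [f₂ 4 (by decide), f₁ 4 (by decide), hx j hj]
  · rw [f₂ 13 (by decide), f₁ 13 (by decide), hq]
  · funext i
    obtain ⟨h19, h20⟩ := hpt i i.2
    simp only [queryPoint, h19, h20, nodePoint]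
  · rw [h₄]
    exact (hb₃.write (hnum.trans (by omega)) _ _).write (hden.trans (by omega)) _ _
  · have hb₄ : Bdd b t₄.mem := by
      rw [h₄]
      exact (hb₃.write (hnum.trans (by omega)) _ _).write (hden.trans (by omega)) _ _
    have e23 : t₄.mem 23 0 = t₂.mem 23 0 := by rw [f₄ 23 (by decide), f₃ 23 (by decide)]
    have e24 : t₄.mem 24 0 = t₂.mem 24 0 := by rw [f₄ 24 (by decide), f₃ 24 (by decide)]
    have e25 : t₄.mem 25 0 = lagrangeDen k (d + 1) := by
      rw [f₄ 25 (by decide), f₃ 25 (by decide), hD]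
    rw [hD] at b25
    have e27 : t₄.mem 27 0 = s.mem 27 0 := by
      rw [f₄ 27 (by decide), f₃ 27 (by decide), f₂ 27 (by decide), f₁ 27 (by decide)]
    have e28 : t₄.mem 28 0 = s.mem 28 0 := by
      rw [f₄ 28 (by decide), f₃ 28 (by decide), f₂ 28 (by decide), f₁ 28 (by decide)]
    have e29 : t₄.mem 29 0 = s.mem 29 0 := by
      rw [f₄ 29 (by decide), f₃ 29 (by decide), f₂ 29 (by decide), f₁ 29 (by decide)]
    have e21 : t₄.mem 21 0 = (F (nodePoint n x q k)).num := by
      rw [h₄]; simp [Memory.write_apply]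
    have e22 : t₄.mem 22 0 = (F (nodePoint n x q k)).den := by
      rw [h₄]; simp [Memory.write_apply]
    have hratio : (F (nodePoint n x q k) : ℂ) =
        ((F (nodePoint n x q k)).num : ℂ) / ((F (nodePoint n x q k)).den : ℤ) := by
      rw [Rat.cast_def]; norm_cast
    have hden0 : ((F (nodePoint n x q k)).den : ℤ) ≠ 0 := by exact_mod_cast Rat.den_ne_zero _
    have hD0 := lagrangeDen_ne_zero k (d + 1)
    rw [hratio]
    -- From here on only the sizes of the numerator and denominator and the nonvanishing of the
    -- latter matter, so both become arbitrary integers.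
    revert hden0 hnum hden e21 e22
    generalize (F (nodePoint n x q k)).num = u
    generalize ((F (nodePoint n x q k)).den : ℤ) = v
    intro hu hv e21 e22 hv0
    have k27 : ∀ y w : ℤ, bitLen y ≤ 1 + k * (β + ω + 1) → bitLen w ≤ ω →
        bitLen (y * v * lagrangeDen k (d + 1) + u * w * s.mem 29 0) ≤
        1 + (k + 1) * (β + ω + 1) := by
      intro y w hy hw
      refine (bitLen_add_le (k := 1 + k * (β + ω + 1) + β + ω)
        (bitLen_mul_le (bitLen_mul_le hy hv) b25)
        ((bitLen_mul_le (bitLen_mul_le hu hw) hb29).trans (by omega))).trans ?_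
      rw [add_mul]; omega
    have k27' := k27 _ _ hb27 b23
    have k28' := k27 _ _ hb28 b24
    have k29' : bitLen (s.mem 29 0 * v * lagrangeDen k (d + 1)) ≤ 1 + (k + 1) * (β + ω + 1) := by
      refine (bitLen_mul_le (bitLen_mul_le hb29 hv) b25).trans ?_
      rw [add_mul]; omega
    simp only [accumBody, Program.run, Expr.eval, Memory.write_apply, Nat.reduceEqDiff, false_and,
      if_false, and_self, if_true, e21, e22, e23, e24, e25, e27, e28, e29]
    refine ⟨((hb₄.write (by omega) _ _).write (by omega) _ _).write (by omega) _ _,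
      mul_ne_zero (mul_ne_zero hE hv0) hD0, ?_, k27', k28', k29'⟩
    have hDc : (lagrangeDen k (d + 1) : ℂ) ≠ 0 := by exact_mod_cast hD0
    have hvc : (v : ℂ) ≠ 0 := by exact_mod_cast hv0
    push_cast
    field_simp
    linear_combination v * (lagrangeDen k (d + 1)) * hS + u * s.mem 29 0 * hN

theorem valuePhase_spec {s : State} {b d β : ℕ} {x : ℕ → ℤ} {q K : ℤ}
    (hβ : 1 ≤ β) (hdβ : d ≤ β) (hnb : n ≤ b)
    (hβb : 1 + (d + 1) * (β + (1 + 2 * β * (d + 1)) + 1) ≤ b)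
    (hb : Bdd b s.mem) (hn : s.mem 0 0 = n) (hd : s.mem 0 1 = d)
    (hx : ∀ k < 2 * n, s.mem 4 (k : ℕ) = x k) (hq : s.mem 13 0 = q)
    (hK : s.mem 11 0 = K) (hK0 : 0 < K)
    (hxb : ∀ k, bitLen (x k) ≤ β) (hqb : bitLen q ≤ β)
    (hnum : ∀ k ≤ d, bitLen (F (nodePoint n x q k)).num ≤ β)
    (hden : ∀ k ≤ d, bitLen (F (nodePoint n x q k)).den ≤ β) :
    Triple F valuePhase s (valueTime n d b) fun s' =>
      (s'.mem 3 0 = 1 ↔ s.mem 3 0 = 1 ∧ 1 ≤ ‖lagrangeSum F x q d (d + 1)‖ * K) := by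
  set ω := 1 + 2 * β * (d + 1) with hω
  have hb1 : bitLen 1 ≤ b := by rw [bitLen_one]; omega
  refine Triple.seq (Q := fun t => Bdd b t.mem ∧ t.mem 27 0 = 0 ∧ t.mem 28 0 = 0 ∧
    t.mem 29 0 = 1) (Triple.straight rfl hb ?_) fun t₁ f₁ ⟨hb₁, h27, h28, h29⟩ =>
    Triple.seq (Triple.forLoop (M := d + 1) (b := b) (τ := nodeTime n d b)
      (Inv := fun k t => t.mem 29 0 ≠ 0 ∧
      (t.mem 27 0 : ℂ) + t.mem 28 0 * Complex.I = t.mem 29 0 * lagrangeSum F x q d k ∧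
      bitLen (t.mem 27 0) ≤ 1 + k * (β + ω + 1) ∧
      bitLen (t.mem 28 0) ≤ 1 + k * (β + ω + 1) ∧
      bitLen (t.mem 29 0) ≤ 1 + k * (β + ω + 1)) (by decide) ?_
      (bitLen_natCast_le_of_le (by nlinarith)) hb₁ ?_ ?_) fun t₂ f₂ ⟨_, hb₂, hE, hS, _⟩ =>
      Triple.straight rfl hb₂ ?_
  · simp only [interpolationInit, Program.run, Expr.eval]
    refine ⟨((hb.write (by simp) _ _).write (by simp) _ _).write hb1 _ _, ?_⟩
    simp [Memory.write_apply]
  · intro t ht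
    simp [succDegree, Expr.eval, ht 0 (by decide) (by decide), f₁ 0 (by decide), hd]
  · simp [Memory.write_apply, h27, h28, h29, lagrangeSum]
  · intro k hk t ht hk' hbt ⟨iE, iS, i27, i28, i29⟩
    refine (nodeBody_spec (x := x) (q := q) (k := k) hβ hdβ hnb (by omega) hβb hbt ?_ ?_ hk' ?_ ?_
      hxb hqb (hnum k (by omega)) (hden k (by omega)) iE iS i27 i28 i29).weaken le_rfl ?_
    · rw [ht 0 (by decide) (by decide), f₁ 0 (by decide), hn]
    · rw [ht 0 (by decide) (by decide), f₁ 0 (by decide), hd]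
    · intro j hj
      rw [ht 4 (by decide) (by decide), f₁ 4 (by decide), hx j hj]
    · rw [ht 13 (by decide) (by decide), f₁ 13 (by decide), hq]
    · intro t' _ ⟨hb', h⟩
      refine ⟨hb', ?_⟩
      simpa [Memory.write_apply, lagrangeSum, sum_range_succ] using h
  · have h11 : t₂.mem 11 0 = K := by rw [f₂ 11 (by decide), f₁ 11 (by decide), hK]
    have h3 : t₂.mem 3 0 = s.mem 3 0 := by rw [f₂ 3 (by decide), f₁ 3 (by decide)]
    have hiff : 0 < Expr.eval t₂.mem (.sub (.mul (.var 29) (.var 29)) (.mul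
        (.add (.mul (.var 27) (.var 27)) (.mul (.var 28) (.var 28))) (.mul (.var 11) (.var 11)))) ↔
        ‖lagrangeSum F x q d (d + 1)‖ * K < 1 := by
      simp only [Expr.eval, h11]
      exact zero_lt_sq_sub_iff hS hE hK0
    simp only [valueCheck, Program.run]
    by_cases hc : ‖lagrangeSum F x q d (d + 1)‖ * K < 1
    · rw [if_pos (hiff.2 hc)]
      simp [Memory.write_apply, Expr.eval, hc]
    · rw [if_neg (hiff.not.2 hc)]
      simp only [h3, not_lt.1 hc, and_true]

end BlackBoxMachine

section

open Finset

/-! ### Ideal membership and common zeros -/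

section Ideal

open MvPolynomial

variable {n : ℕ}

theorem aeval_eq_zero_of_mem_univariateIdeal {p : Fin n → Polynomial ℚ} {α : Fin n → ℂ}
    (hα : ∀ i, Polynomial.aeval (α i) (p i) = 0) {f : MvPolynomial (Fin n) ℚ}
    (hf : f ∈ univariateIdeal p) : aeval α f = 0 := by
  have h : univariateIdeal p ≤ RingHom.ker (aeval α : MvPolynomial (Fin n) ℚ →ₐ[ℚ] ℂ) := by
    refine Ideal.span_le.2 ?_
    rintro _ ⟨i, rfl⟩
    rw [SetLike.mem_coe, RingHom.mem_ker, ← Polynomial.aeval_algHom_apply, aeval_X, hα]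
  exact h hf

theorem degreeOf_aeval_X_le (i j : Fin n) (h : Polynomial ℚ) :
    degreeOf i (Polynomial.aeval (X j : MvPolynomial (Fin n) ℚ) h) ≤
      if j = i then h.natDegree else 0 := by
  rw [Polynomial.aeval_eq_sum_range]
  refine (degreeOf_sum_le _ _ _).trans (Finset.sup_le fun k hk => ?_)
  rw [MvPolynomial.smul_eq_C_mul]
  refine (degreeOf_C_mul_le _ _ _).trans ?_
  split_ifs with hij
  · subst hij
    rw [degreeOf_X_self_pow]
    exact Nat.lt_succ_iff.1 (mem_range.1 hk)
  · rw [degreeOf_X_pow_of_ne _ (Ne.symm hij)]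

/-- Division with remainder by the generators. -/
theorem exists_reduced {p : Fin n → Polynomial ℚ} (hp : ∀ i, 0 < (p i).natDegree)
    (f : MvPolynomial (Fin n) ℚ) :
    ∃ r : MvPolynomial (Fin n) ℚ, f - r ∈ univariateIdeal p ∧
      ∀ i, r.degreeOf i < (p i).natDegree := by
  refine ⟨∑ e ∈ f.support, C (f.coeff e) *
    ∏ i, Polynomial.aeval (X i : MvPolynomial (Fin n) ℚ) (Polynomial.X ^ e i % p i), ?_,
    fun i => ?_⟩
  · rw [← Ideal.Quotient.mk_eq_mk_iff_sub_mem]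
    conv_lhs => rw [f.as_sum]
    simp only [map_sum, monomial_eq, map_mul, map_prod, Finsupp.prod_fintype, pow_zero,
      implies_true]
    refine sum_congr rfl fun e _ => ?_
    congr 1
    refine prod_congr rfl fun i _ => ?_
    rw [Ideal.Quotient.mk_eq_mk_iff_sub_mem]
    have h := EuclideanDomain.div_add_mod (Polynomial.X ^ e i) (p i)
    have h' : (X i : MvPolynomial (Fin n) ℚ) ^ e i -
        Polynomial.aeval (X i) (Polynomial.X ^ e i % p i) =
        Polynomial.aeval (X i) (Polynomial.X ^ e i / p i) *
          Polynomial.aeval (X i : MvPolynomial (Fin n) ℚ) (p i) := by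
      have hX : (X i : MvPolynomial (Fin n) ℚ) ^ e i =
          Polynomial.aeval (X i : MvPolynomial (Fin n) ℚ)
            (Polynomial.X ^ e i : Polynomial ℚ) := by simp
      rw [hX]
      have h2 := congrArg (Polynomial.aeval (X i : MvPolynomial (Fin n) ℚ)) h
      rw [map_add, map_mul] at h2
      linear_combination -h2
    rw [h']
    exact Ideal.mul_mem_left _ _ (Ideal.subset_span ⟨i, rfl⟩)
  · refine (degreeOf_sum_le _ _ _).trans_lt ((Finset.sup_lt_iff (hp i)).2 fun e _ => ?_)
    refine (degreeOf_C_mul_le _ _ _).trans_lt ((degreeOf_prod_le _ _ _).trans_lt ?_)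
    refine (sum_le_sum fun j _ => degreeOf_aeval_X_le i j _).trans_lt ?_
    rw [sum_ite_eq' univ i, if_pos (mem_univ _)]
    exact Polynomial.natDegree_mod_lt _ (hp i).ne'

/-- The remainder r of f has degree below deg p_i in each variable. If f vanishes at all common
zeros, r vanishes on a product of root sets with exactly deg p_i elements, simplicity of the roots
entering here, and so r = 0. -/
theorem not_mem_univariateIdeal_iff {p : Fin n → Polynomial ℚ} (hp : ∀ i, HasDistinctRoots (p i))
    (f : MvPolynomial (Fin n) ℚ) : f ∉ univariateIdeal p ↔
      ∃ α : Fin n → ℂ, (∀ i, Polynomial.aeval (α i) (p i) = 0) ∧ aeval α f ≠ 0 := by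
  refine ⟨fun hf => ?_, fun ⟨α, hα, h⟩ hf => h (aeval_eq_zero_of_mem_univariateIdeal hα hf)⟩
  by_contra! hc
  apply hf
  by_cases hdeg : ∀ i, 0 < (p i).natDegree
  · obtain ⟨r, hr, hd⟩ := exists_reduced hdeg f
    have hr0 : map (algebraMap ℚ ℂ) r = 0 := by
      refine eq_zero_of_eval_zero_at_prod_finset _
        (fun i => ((p i).map (algebraMap ℚ ℂ)).roots.toFinset) (fun i => ?_) fun α hα => ?_
      · rw [Multiset.toFinset_card_of_nodup (hp i).2,
          ← (IsAlgClosed.splits _).natDegree_eq_card_roots, Polynomial.natDegree_map]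
        refine lt_of_le_of_lt ?_ (hd i)
        exact degreeOf_le_iff.2 fun e he => degreeOf_le_iff.1 le_rfl e (support_map_subset _ _ he)
      · have hα' : ∀ i, Polynomial.aeval (α i) (p i) = 0 := by
          intro i
          have := hα i
          rw [Multiset.mem_toFinset, Polynomial.mem_roots', Polynomial.IsRoot.def,
            Polynomial.eval_map_algebraMap] at this
          exact this.2
        have h1 := aeval_eq_zero_of_mem_univariateIdeal hα' hr
        rw [map_sub, hc α hα', zero_sub, neg_eq_zero] at h1
        rw [eval_map, ← aeval_def, h1]
    have : r = 0 := map_injective _ (algebraMap ℚ ℂ).injective (by rw [hr0, map_zero])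
    rwa [this, sub_zero] at hr
  -- A constant `p i` allows no remainder of smaller degree, but being nonzero it is a unit, and the
  -- ideal is everything.
  · push Not at hdeg
    obtain ⟨i, hi⟩ := hdeg
    have hC := Polynomial.eq_C_of_natDegree_le_zero hi
    have h0 : (p i).coeff 0 ≠ 0 := by
      intro h
      apply (hp i).1
      rw [hC, h, map_zero]
    have hmem : Polynomial.aeval (X i : MvPolynomial (Fin n) ℚ) (p i) ∈ univariateIdeal p :=
      Ideal.subset_span ⟨i, rfl⟩
    rw [hC, Polynomial.aeval_C] at hmem
    have := Ideal.mul_mem_left _ (f * C ((p i).coeff 0)⁻¹) hmem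
    rwa [mul_assoc, algebraMap_eq, ← C_mul, inv_mul_cancel₀ h0, C_1, mul_one] at this

end Ideal

/-! ### Conjugates of algebraic integers -/

section Conjugates

/-- The norm is the product of all conjugates and a nonzero rational integer, so the conjugates
cannot all be smaller than 1. -/
theorem exists_one_le_norm_conjugate {K : Type*} [Field K] [Algebra ℚ K] [FiniteDimensional ℚ K]
    (b : K) (hb : b ≠ 0) (hint : IsIntegral ℤ b) : ∃ σ : K →ₐ[ℚ] ℂ, 1 ≤ ‖σ b‖ := by
  classical
  by_contra! hc
  have hn := Algebra.norm_eq_prod_embeddings ℚ ℂ b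
  obtain ⟨z, hz⟩ := IsIntegrallyClosed.isIntegral_iff.1 (Algebra.isIntegral_norm ℚ hint)
  have hz0 : z ≠ 0 := by
    rintro rfl
    rw [map_zero] at hz
    exact hb (Algebra.norm_eq_zero_iff.1 hz.symm)
  have h1 : (1 : ℝ) ≤ ‖algebraMap ℚ ℂ (Algebra.norm ℚ b)‖ := by
    rw [← hz]
    simp only [eq_intCast, map_intCast, Complex.norm_intCast]
    exact_mod_cast Int.one_le_abs hz0
  -- An embedding is needed to make the product strictly less than 1; the empty product would be 1.
  obtain ⟨σ₀⟩ : Nonempty (K →ₐ[ℚ] ℂ) := ⟨IsAlgClosed.lift⟩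
  rw [hn, norm_prod] at h1
  have : ∏ σ : K →ₐ[ℚ] ℂ, ‖σ b‖ < 1 := by
    rw [← mul_prod_erase _ _ (mem_univ σ₀)]
    exact mul_lt_one_of_nonneg_of_lt_one_left (norm_nonneg _) (hc σ₀)
      (prod_le_one (fun _ _ => norm_nonneg _) fun σ _ => (hc σ).le)
  linarith

/-- In the number field generated by all coordinates, a single embedding moves the whole point α at
once, to a point whose coordinates are roots of the same rational polynomials. No lower bound is
obtained for f(α) itself. -/
theorem exists_one_le_norm_aeval {n : ℕ} {p : Fin n → Polynomial ℚ} (hp : ∀ i, p i ≠ 0)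
    {f : MvPolynomial (Fin n) ℚ} {α : Fin n → ℂ} (hα : ∀ i, Polynomial.aeval (α i) (p i) = 0)
    (hf : MvPolynomial.aeval α f ≠ 0) {A : ℤ} (hA : A ≠ 0)
    (hint : IsIntegral ℤ ((A : ℂ) * MvPolynomial.aeval α f)) :
    ∃ α' : Fin n → ℂ, (∀ i, Polynomial.aeval (α' i) (p i) = 0) ∧
      1 ≤ |(A : ℝ)| * ‖MvPolynomial.aeval α' f‖ := by
  have : FiniteDimensional ℚ (IntermediateField.adjoin ℚ (Set.range α)) := by
    refine IntermediateField.finiteDimensional_adjoin ?_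
    rintro _ ⟨i, rfl⟩
    exact IsAlgebraic.isIntegral ⟨p i, hp i, hα i⟩
  let a : Fin n → IntermediateField.adjoin ℚ (Set.range α) :=
    fun i => ⟨α i, IntermediateField.subset_adjoin _ _ ⟨i, rfl⟩⟩
  let ι := (IntermediateField.adjoin ℚ (Set.range α)).val
  have hfa : ι (MvPolynomial.aeval a f) = MvPolynomial.aeval α f := MvPolynomial.comp_aeval_apply a ι f
  have hιA : ι ((A : IntermediateField.adjoin ℚ (Set.range α)) * MvPolynomial.aeval a f) =
      (A : ℂ) * MvPolynomial.aeval α f := by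
    rw [map_mul, hfa, map_intCast]
  obtain ⟨σ, hσ⟩ := exists_one_le_norm_conjugate
    ((A : IntermediateField.adjoin ℚ (Set.range α)) * MvPolynomial.aeval a f)
    (by
      intro h
      rw [h, map_zero] at hιA
      exact mul_ne_zero (by exact_mod_cast hA) hf hιA.symm)
    ((isIntegral_algHom_iff (ι.restrictScalars ℤ) ι.injective).1 (by
      rw [AlgHom.restrictScalars_apply, hιA]; exact hint))
  refine ⟨fun i => σ (a i), fun i => ?_, ?_⟩
  · have h0 : Polynomial.aeval (a i) (p i) = 0 := by
      apply ι.toRingHom.injective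
      change ι _ = ι 0
      rw [← Polynomial.aeval_algHom_apply, map_zero]
      exact hα i
    rw [Polynomial.aeval_algHom_apply, h0, map_zero]
  · rw [map_mul, map_intCast, norm_mul, Complex.norm_intCast] at hσ
    rw [MvPolynomial.comp_aeval_apply] at hσ
    exact hσ

end Conjugates

namespace BlackBoxMachine

/-! ### The interpolation formula -/

theorem ratCast_eval {n : ℕ} (a : Fin n → ℚ) (f : MvPolynomial (Fin n) ℚ) :
    ((MvPolynomial.eval a f : ℚ) : ℂ) = MvPolynomial.aeval (fun i => (a i : ℂ)) f := by
  simpa using MvPolynomial.comp_aeval_apply a (Algebra.ofId ℚ ℂ) f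

/-- Along the line t ↦ (a + tb)/q, f is a polynomial in t of degree at most d, determined by its
values at the d + 1 nodes 0, …, d; its value at t = i is f at the complex point. -/
theorem lagrangeSum_eq {n d : ℕ} {f : MvPolynomial (Fin n) ℚ} (hf : f.totalDegree ≤ d)
    (x : ℕ → ℤ) (q : ℤ) :
    lagrangeSum (fun a => MvPolynomial.eval a f) x q d (d + 1) =
      MvPolynomial.aeval (fun i : Fin n => ((x i : ℂ) + x (n + i) * Complex.I) / q) f := by
  let φ : Fin n → Polynomial ℂ := fun i =>
    Polynomial.C ((x (n + i) : ℂ) / q) * Polynomial.X + Polynomial.C ((x i : ℂ) / q)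
  let G : Polynomial ℂ := MvPolynomial.aeval φ (MvPolynomial.map (algebraMap ℚ ℂ) f)
  have hG : ∀ t : ℂ, G.eval t =
      MvPolynomial.aeval (fun i : Fin n => ((x i : ℂ) + x (n + i) * t) / q) f := by
    intro t
    have := MvPolynomial.comp_aeval_apply φ (Polynomial.aeval t)
      (MvPolynomial.map (algebraMap ℚ ℂ) f)
    rw [Polynomial.coe_aeval_eq_eval] at this
    rw [this, MvPolynomial.aeval_map_algebraMap]
    congr 2
    funext i
    simp only [φ, Polynomial.eval_add, Polynomial.eval_mul,
      Polynomial.eval_C, Polynomial.eval_X]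
    ring
  have hdeg : G.natDegree ≤ d := by
    have := MvPolynomial.aeval_natDegree_le (m := d) (n := 1)
      (MvPolynomial.map (algebraMap ℚ ℂ) f)
      ((Finset.sup_mono (MvPolynomial.support_map_subset _ _)).trans hf) φ fun i => Polynomial.natDegree_linear_le
    simpa using this
  have hinj : Set.InjOn (fun m : ℕ => (m : ℂ)) (range (d + 1)) := 
    Nat.cast_injective.injOn
  have hlag := Lagrange.eq_interpolate hinj (f := G)
    (Polynomial.degree_le_natDegree.trans_lt (by
      rw [card_range]; exact_mod_cast Nat.lt_succ_of_le hdeg))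
  rw [← hG, hlag, Lagrange.interpolate_apply, Polynomial.eval_finsetSum]
  refine sum_congr rfl fun m hm => ?_
  rw [Polynomial.eval_mul, Polynomial.eval_C, hG]
  congr 1
  · rw [ratCast_eval]
    congr 2
    funext i
    simp only [nodePoint]
    push_cast
    ring
  · have hsplit : ∀ g : ℕ → ℂ, (∏ l ∈ range (d + 1), if l = m then 1 else g l) =
        ∏ l ∈ (range (d + 1)).erase m, g l := by
      intro g
      rw [← mul_prod_erase _ _ hm, if_pos rfl, one_mul]
      exact prod_congr rfl fun l hl => if_neg (ne_of_mem_erase hl)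
    have hden : ((lagrangeDen m (d + 1) : ℤ) : ℂ) =
        ∏ l ∈ (range (d + 1)).erase m, ((m : ℂ) - l) := by
      rw [← hsplit, lagrangeDen]
      push_cast
      exact prod_congr rfl fun l _ => by split_ifs <;> simp
    rw [hden, lagrangeNum, hsplit, Lagrange.basis, Polynomial.eval_prod, ← prod_div_distrib]
    refine prod_congr rfl fun l _ => ?_
    rw [Lagrange.basisDivisor]
    simp
    ring

end BlackBoxMachine

end

section

open Finset BlackBoxMachine

/-! ### Size, perturbation and root estimates -/

section Estimates

theorem abs_le_two_pow_of_bitLen_num {c : ℚ} {L : ℕ} (h : bitLen c.num ≤ L) :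
    ‖(c : ℂ)‖ ≤ 2 ^ L := by
  have h1 : (|c.num| : ℝ) ≤ 2 ^ L := by exact_mod_cast (bitLen_le.1 h).le
  have h2 : (1 : ℝ) ≤ c.den := by exact_mod_cast c.den_pos
  have h3 : ‖(c : ℂ)‖ = |(c.num : ℝ)| / c.den := by
    rw [show (c : ℂ) = ((c : ℝ) : ℂ) by norm_cast, Complex.norm_real, Real.norm_eq_abs,
      Rat.cast_def, abs_div, Nat.abs_cast]
  rw [h3]
  exact (div_le_self (abs_nonneg _) h2).trans h1

theorem inv_two_pow_le_of_bitLen_den {c : ℚ} {L : ℕ} (hc : c ≠ 0) (h : bitLen c.den ≤ L) :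
    (2 ^ L : ℝ)⁻¹ ≤ ‖(c : ℂ)‖ := by
  have h1 : (c.den : ℝ) ≤ 2 ^ L := by
    have := (bitLen_le.1 h).le
    rw [Nat.abs_cast] at this
    exact_mod_cast this
  have h2 : (0 : ℝ) < c.den := by exact_mod_cast c.den_pos
  have h4 : (1 : ℝ) ≤ |(c.num : ℝ)| := by
    exact_mod_cast Int.one_le_abs (Rat.num_ne_zero.2 hc)
  have h3 : ‖(c : ℂ)‖ = |(c.num : ℝ)| / c.den := by
    rw [show (c : ℂ) = ((c : ℝ) : ℂ) by norm_cast, Complex.norm_real, Real.norm_eq_abs,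
      Rat.cast_def, abs_div, Nat.abs_cast]
  rw [h3, inv_eq_one_div]
  gcongr

theorem norm_pow_sub_pow_le' {z w : ℂ} {ρ δ : ℝ} (hρ : 1 ≤ ρ) (hz : ‖z‖ ≤ ρ)
    (hw : ‖w‖ ≤ ρ) (h : ‖z - w‖ ≤ δ) (k : ℕ) : ‖z ^ k - w ^ k‖ ≤ k * ρ ^ k * δ := by
  have hδ : 0 ≤ δ := (norm_nonneg _).trans h
  induction k with
  | zero => simp
  | succ k ih =>
    have hρk : ρ ^ k ≤ ρ ^ (k + 1) := pow_le_pow_right₀ hρ (Nat.le_succ k)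
    calc ‖z ^ (k + 1) - w ^ (k + 1)‖ = ‖z ^ k * (z - w) + (z ^ k - w ^ k) * w‖ := by
          congr 1; ring
      _ ≤ ‖z ^ k * (z - w)‖ + ‖(z ^ k - w ^ k) * w‖ := norm_add_le _ _
      _ ≤ ρ ^ k * δ + k * ρ ^ k * δ * ρ := by
          rw [norm_mul, norm_mul, norm_pow]
          gcongr
      _ ≤ ρ ^ (k + 1) * δ + k * ρ ^ k * δ * ρ := by gcongr
      _ = ((k + 1 : ℕ) : ℝ) * ρ ^ (k + 1) * δ := by push_cast; ring

variable {n : ℕ}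

theorem norm_prod_pow_le {z : Fin n → ℂ} {ρ : ℝ} (hz : ∀ i, ‖z i‖ ≤ ρ)
    (e : Fin n → ℕ) (s : Finset (Fin n)) : ‖∏ i ∈ s, z i ^ e i‖ ≤ ρ ^ (∑ i ∈ s, e i) := by
  rw [norm_prod, ← prod_pow_eq_pow_sum]
  refine prod_le_prod (fun _ _ => norm_nonneg _) fun i _ => ?_
  rw [norm_pow]
  gcongr
  exact hz i

/-- Telescoping: one factor is exchanged at a time while the others are bounded by powers of ρ. -/
theorem norm_prod_pow_sub_le {z w : Fin n → ℂ} {ρ δ : ℝ} (hρ : 1 ≤ ρ) (hδ : 0 ≤ δ)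
    (hz : ∀ i, ‖z i‖ ≤ ρ) (hw : ∀ i, ‖w i‖ ≤ ρ) (h : ∀ i, ‖z i - w i‖ ≤ δ) (e : Fin n → ℕ)
    (s : Finset (Fin n)) : ‖∏ i ∈ s, z i ^ e i - ∏ i ∈ s, w i ^ e i‖ ≤
      (∑ i ∈ s, e i : ℕ) * ρ ^ (∑ i ∈ s, e i) * δ := by
  have hρ0 : 0 ≤ ρ := by linarith
  induction s using Finset.induction_on with
  | empty => simp
  | insert i s hi ih =>
    rw [prod_insert hi, prod_insert hi, sum_insert hi]
    calc ‖z i ^ e i * ∏ j ∈ s, z j ^ e j - w i ^ e i * ∏ j ∈ s, w j ^ e j‖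
        = ‖z i ^ e i * (∏ j ∈ s, z j ^ e j - ∏ j ∈ s, w j ^ e j) +
            (z i ^ e i - w i ^ e i) * ∏ j ∈ s, w j ^ e j‖ := by congr 1; ring
      _ ≤ ‖z i ^ e i * (∏ j ∈ s, z j ^ e j - ∏ j ∈ s, w j ^ e j)‖ +
            ‖(z i ^ e i - w i ^ e i) * ∏ j ∈ s, w j ^ e j‖ := norm_add_le _ _
      _ ≤ ρ ^ e i * ((∑ j ∈ s, e j : ℕ) * ρ ^ (∑ j ∈ s, e j) * δ) +
            (e i * ρ ^ e i * δ) * ρ ^ (∑ j ∈ s, e j) := by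
          rw [norm_mul, norm_mul, norm_pow]
          gcongr
          · exact hz i
          · exact norm_pow_sub_pow_le' hρ (hz i) (hw i) (h i) (e i)
          · exact norm_prod_pow_le hw e s
      _ = _ := by push_cast; rw [pow_add]; ring

theorem aeval_eq_sum_prod (f : MvPolynomial (Fin n) ℚ) (z : Fin n → ℂ) :
    MvPolynomial.aeval z f = ∑ e ∈ f.support, ((f.coeff e : ℚ) : ℂ) * ∏ i, z i ^ e i := by
  rw [MvPolynomial.aeval_def, MvPolynomial.eval₂_eq']
  rfl

theorem sum_le_of_mem_support {f : MvPolynomial (Fin n) ℚ} {d : ℕ} (hf : f.totalDegree ≤ d)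
    {e : Fin n →₀ ℕ} (he : e ∈ f.support) : ∑ i, e i ≤ d := by
  have := MvPolynomial.le_totalDegree he
  rw [Finsupp.sum_fintype _ _ (fun _ => rfl)] at this
  exact this.trans hf

/-- The exponents lie in a box of side d + 1. The count is exponential in n, but only its logarithm
enters the precision. -/
theorem card_support_le {f : MvPolynomial (Fin n) ℚ} {d : ℕ} (hf : f.totalDegree ≤ d) :
    f.support.card ≤ (d + 1) ^ n := by
  classical
  have : f.support.card ≤ (Fintype.piFinset fun _ : Fin n => range (d + 1)).card := by
    refine card_le_card_of_injOn (fun e => ⇑e) (fun e he => ?_) DFunLike.coe_injective.injOn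
    rw [mem_coe, Fintype.mem_piFinset]
    intro i
    rw [mem_range, Nat.lt_succ_iff]
    exact (single_le_sum (f := fun i => e i) (fun _ _ => Nat.zero_le _) (mem_univ i)).trans
      (sum_le_of_mem_support hf he)
  simpa using this

theorem norm_aeval_le {f : MvPolynomial (Fin n) ℚ} {d L : ℕ} (hf : f.totalDegree ≤ d)
    (hL : ∀ e, bitLen (f.coeff e).num ≤ L) {z : Fin n → ℂ} {ρ : ℝ} (hρ : 1 ≤ ρ)
    (hz : ∀ i, ‖z i‖ ≤ ρ) : ‖MvPolynomial.aeval z f‖ ≤ (d + 1) ^ n * (2 ^ L * ρ ^ d) := by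
  have hρ0 : 0 ≤ ρ := by linarith
  rw [aeval_eq_sum_prod]
  refine (norm_sum_le _ _).trans ?_
  calc ∑ e ∈ f.support, ‖((f.coeff e : ℚ) : ℂ) * ∏ i, z i ^ e i‖
      ≤ ∑ _e ∈ f.support, 2 ^ L * ρ ^ d := by
        refine sum_le_sum fun e he => ?_
        rw [norm_mul]
        gcongr
        · exact abs_le_two_pow_of_bitLen_num (hL e)
        · exact (norm_prod_pow_le hz e univ).trans
            (pow_le_pow_right₀ hρ (sum_le_of_mem_support hf he))
    _ ≤ _ := by
        rw [sum_const, nsmul_eq_mul]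
        gcongr
        exact_mod_cast card_support_le hf

theorem norm_aeval_sub_le {f : MvPolynomial (Fin n) ℚ} {d L : ℕ} (hf : f.totalDegree ≤ d)
    (hL : ∀ e, bitLen (f.coeff e).num ≤ L) {z w : Fin n → ℂ} {ρ δ : ℝ} (hρ : 1 ≤ ρ)
    (hδ : 0 ≤ δ) (hz : ∀ i, ‖z i‖ ≤ ρ) (hw : ∀ i, ‖w i‖ ≤ ρ) (h : ∀ i, ‖z i - w i‖ ≤ δ) :
    ‖MvPolynomial.aeval z f - MvPolynomial.aeval w f‖ ≤
      (d + 1) ^ n * (2 ^ L * (d * ρ ^ d * δ)) := by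
  have hρ0 : 0 ≤ ρ := by linarith
  rw [aeval_eq_sum_prod, aeval_eq_sum_prod, ← sum_sub_distrib]
  refine (norm_sum_le _ _).trans ?_
  calc ∑ e ∈ f.support, ‖((f.coeff e : ℚ) : ℂ) * ∏ i, z i ^ e i - ((f.coeff e : ℚ) : ℂ) * ∏ i, w i ^ e i‖
      ≤ ∑ _e ∈ f.support, 2 ^ L * (d * ρ ^ d * δ) := by
        refine sum_le_sum fun e he => ?_
        rw [← mul_sub, norm_mul]
        gcongr
        · exact abs_le_two_pow_of_bitLen_num (hL e)
        · refine (norm_prod_pow_sub_le hρ hδ hz hw h e univ).trans ?_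
          gcongr
          all_goals first | exact hρ | exact sum_le_of_mem_support hf he
    _ ≤ _ := by
        rw [sum_const, nsmul_eq_mul]
        gcongr
        exact_mod_cast card_support_le hf

theorem norm_polynomial_aeval_sub_le {p : Polynomial ℚ} {d L : ℕ} (hd : p.natDegree ≤ d)
    (hL : ∀ j, bitLen (p.coeff j).num ≤ L) {z w : ℂ} {ρ δ : ℝ} (hρ : 1 ≤ ρ)
    (hz : ‖z‖ ≤ ρ) (hw : ‖w‖ ≤ ρ) (h : ‖z - w‖ ≤ δ) :
    ‖Polynomial.aeval z p - Polynomial.aeval w p‖ ≤ (d + 1) * (2 ^ L * (d * ρ ^ d * δ)) := by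
  have hδ : 0 ≤ δ := (norm_nonneg _).trans h
  have hρ0 : 0 ≤ ρ := by linarith
  rw [Polynomial.aeval_eq_sum_range' (Nat.lt_succ_of_le hd),
    Polynomial.aeval_eq_sum_range' (Nat.lt_succ_of_le hd), ← sum_sub_distrib]
  refine (norm_sum_le _ _).trans ?_
  calc ∑ j ∈ range (d + 1), ‖p.coeff j • z ^ j - p.coeff j • w ^ j‖
      ≤ ∑ _j ∈ range (d + 1), 2 ^ L * (d * ρ ^ d * δ) := by
        refine sum_le_sum fun j hj => ?_
        have hj' : j ≤ d := Nat.lt_succ_iff.1 (mem_range.1 hj)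
        rw [← smul_sub, Rat.smul_def, norm_mul]
        gcongr
        · exact abs_le_two_pow_of_bitLen_num (hL j)
        · refine (norm_pow_sub_pow_le' hρ hz hw h j).trans ?_
          gcongr
    _ = _ := by rw [sum_const, nsmul_eq_mul, card_range]; push_cast; ring

/-- |p(z)| is the leading coefficient, at least 2^(-L) in absolute value, times the distances to the
roots. If all distances exceeded δ, the product would be too large; δ ≤ 1 lets the exponent d
replace the actual number of roots. -/
theorem exists_root_near {p : Polynomial ℚ} {d L : ℕ} (hp : p ≠ 0) (hd : p.natDegree ≤ d)
    (hL : ∀ j, bitLen (p.coeff j).den ≤ L) {z : ℂ} {δ : ℝ} (hδ : 0 < δ) (hδ1 : δ ≤ 1)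
    (h : ‖Polynomial.aeval z p‖ < (2 ^ L : ℝ)⁻¹ * δ ^ d) :
    ∃ α : ℂ, Polynomial.aeval α p = 0 ∧ ‖z - α‖ ≤ δ := by
  by_contra! hc
  refine h.not_ge ?_
  have hsplit := IsAlgClosed.splits (p.map (algebraMap ℚ ℂ))
  rw [← Polynomial.eval_map_algebraMap, hsplit.eval_eq_prod_roots, norm_mul,
    Polynomial.leadingCoeff_map]
  gcongr
  · exact inv_two_pow_le_of_bitLen_den (Polynomial.leadingCoeff_ne_zero.2 hp) (hL _)
  · have h1 : δ ^ d ≤ δ ^ (Multiset.card (p.map (algebraMap ℚ ℂ)).roots) := by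
      refine pow_le_pow_of_le_one hδ.le hδ1 ?_
      refine (Polynomial.card_roots' _).trans ?_
      rwa [Polynomial.natDegree_map]
    refine h1.trans ?_
    have key : ∀ S : Multiset ℂ, (∀ α ∈ S, δ ≤ ‖z - α‖) →
        δ ^ (Multiset.card S) ≤ ‖(S.map (z - ·)).prod‖ := by
      intro S
      induction S using Multiset.induction_on with
      | empty => simp
      | cons α S ih =>
        intro hS
        rw [Multiset.card_cons, Multiset.map_cons, Multiset.prod_cons, norm_mul, pow_succ, mul_comm]
        exact mul_le_mul (hS α (Multiset.mem_cons_self _ _))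
          (ih fun β hβ => hS β (Multiset.mem_cons_of_mem hβ)) (by positivity) (norm_nonneg _)
    refine key _ fun α hα => (hc α ?_).le
    rw [Polynomial.mem_roots', Polynomial.IsRoot.def, Polynomial.eval_map_algebraMap] at hα
    exact hα.2

/-- Cauchy's bound: quotients of a coefficient by the leading one are at most 2^L · 2^L. -/
theorem norm_root_le {p : Polynomial ℚ} {L : ℕ} (hp : p ≠ 0)
    (hL : ∀ j, bitLen (p.coeff j).num ≤ L ∧ bitLen (p.coeff j).den ≤ L) {α : ℂ}
    (hα : Polynomial.aeval α p = 0) : ‖α‖ ≤ 2 ^ (2 * L + 1) := by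
  have hp' : p.map (algebraMap ℚ ℂ) ≠ 0 :=
    (Polynomial.map_ne_zero_iff (algebraMap ℚ ℂ).injective).2 hp
  have h : (p.map (algebraMap ℚ ℂ)).IsRoot α := by
    rw [Polynomial.IsRoot.def, Polynomial.eval_map_algebraMap, hα]
  have h1 : ‖α‖ < (Polynomial.cauchyBound (p.map (algebraMap ℚ ℂ)) : ℝ) :=
    h.norm_lt_cauchyBound hp'
  refine h1.le.trans ?_
  have hsup : (((range (p.map (algebraMap ℚ ℂ)).natDegree).sup
      (‖(p.map (algebraMap ℚ ℂ)).coeff ·‖₊) : NNReal)) ≤ (2 ^ L : NNReal) := by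
    refine Finset.sup_le fun j _ => ?_
    rw [Polynomial.coeff_map]
    exact abs_le_two_pow_of_bitLen_num (hL j).1
  have hlc : (2 ^ L : NNReal)⁻¹ ≤ ‖(p.map (algebraMap ℚ ℂ)).leadingCoeff‖₊ := by
    rw [Polynomial.leadingCoeff_map]
    exact inv_two_pow_le_of_bitLen_den (Polynomial.leadingCoeff_ne_zero.2 hp) (hL _).2
  have h2 : Polynomial.cauchyBound (p.map (algebraMap ℚ ℂ)) ≤ 2 ^ (2 * L + 1) := by
    rw [Polynomial.cauchyBound]
    calc _ ≤ (2 ^ L : NNReal) / (2 ^ L : NNReal)⁻¹ + 1 := by gcongr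
      _ = 2 ^ (2 * L) + 1 := by rw [div_inv_eq_mul, ← pow_add, two_mul]
      _ ≤ 2 ^ (2 * L) + 2 ^ (2 * L) := by gcongr; exact one_le_pow₀ (by norm_num)
      _ = 2 ^ (2 * L + 1) := by ring
  exact_mod_cast h2

end Estimates

/-! ### Clearing denominators and the lower bound for nonzero values -/

section Integrality

/-- After multiplication by all d + 1 coefficient denominators, p is integral, and its leading
coefficient times a root is an algebraic integer. The exponent counts d + 1 denominators and one
numerator, L bits each. -/
theorem exists_isIntegral_mul_root {p : Polynomial ℚ} {d L : ℕ} (hp : p ≠ 0)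
    (hd : p.natDegree ≤ d)
    (hL : ∀ j, bitLen (p.coeff j).num ≤ L ∧ bitLen (p.coeff j).den ≤ L) :
    ∃ a : ℤ, a ≠ 0 ∧ |(a : ℝ)| ≤ 2 ^ (L * (d + 2)) ∧
      ∀ α : ℂ, Polynomial.aeval α p = 0 → IsIntegral ℤ ((a : ℂ) * α) := by
  let M : ℕ := ∏ j ∈ range (d + 1), (p.coeff j).den
  have hM : M ≠ 0 := prod_ne_zero_iff.2 fun j _ => Rat.den_ne_zero _
  have hMb : (M : ℝ) ≤ 2 ^ (L * (d + 1)) := by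
    have : M ≤ ∏ _j ∈ range (d + 1), 2 ^ L := prod_le_prod' fun j _ => by
      have := (bitLen_le.1 (hL j).2).le
      rw [Nat.abs_cast] at this
      exact_mod_cast this
    rw [prod_const, card_range, ← pow_mul] at this
    exact_mod_cast this
  have hlift : (Polynomial.C (M : ℚ) * p) ∈ Polynomial.lifts (Int.castRingHom ℚ) := by
    rw [Polynomial.lifts_iff_coeff_lifts]
    intro j
    rw [Polynomial.coeff_C_mul]
    by_cases hj : j ≤ d
    · obtain ⟨c, hc⟩ := dvd_prod_of_mem (fun j => (p.coeff j).den)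
        (mem_range.2 (Nat.lt_succ_of_le hj))
      refine ⟨c * (p.coeff j).num, ?_⟩
      have : (M : ℚ) = (p.coeff j).den * c := by exact_mod_cast hc
      rw [this, eq_intCast]
      push_cast
      rw [mul_comm ((p.coeff j).den : ℚ), mul_assoc, mul_comm ((p.coeff j).den : ℚ),
        Rat.mul_den_eq_num]
    · rw [Polynomial.coeff_eq_zero_of_natDegree_lt (by omega), mul_zero]
      exact ⟨0, map_zero _⟩
  obtain ⟨P, hP⟩ := (Polynomial.mem_lifts _).1 hlift
  have hlc : ((P.leadingCoeff : ℤ) : ℚ) = M * p.leadingCoeff := by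
    have := congrArg Polynomial.leadingCoeff hP
    rw [Polynomial.leadingCoeff_map_of_injective (RingHom.injective_int _),
      Polynomial.leadingCoeff_mul, Polynomial.leadingCoeff_C] at this
    exact this
  refine ⟨P.leadingCoeff, ?_, ?_, fun α hα => ?_⟩
  · intro h
    rw [h, Int.cast_zero, eq_comm, mul_eq_zero] at hlc
    rcases hlc with h | h
    · exact hM (by exact_mod_cast h)
    · exact hp (Polynomial.leadingCoeff_eq_zero.1 h)
  · have h1 := abs_le_two_pow_of_bitLen_num (hL p.natDegree).1
    have h2 : |(P.leadingCoeff : ℝ)| = ‖((P.leadingCoeff : ℚ) : ℂ)‖ := by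
      rw [Rat.cast_intCast, Complex.norm_intCast]
    rw [h2, hlc, Rat.cast_mul, norm_mul, Rat.cast_natCast, Complex.norm_natCast,
      show L * (d + 2) = L * (d + 1) + L by ring, pow_add]
    gcongr
    exact h1
  · have h0 : Polynomial.aeval α P = 0 := by
      have h1 : Polynomial.aeval α (P.map (Int.castRingHom ℚ)) = Polynomial.aeval α P :=
        Polynomial.aeval_map_algebraMap ℚ α P
      rw [← h1, hP, map_mul, hα, mul_zero]
    have := isIntegral_leadingCoeff_smul P α h0
    rwa [zsmul_eq_mul] at this

/-- The multiplier A = D(∏ a_i)^d makes f(α) integral, since D clears the coefficients and no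
variable occurs with exponent above d. The exponent of 2 is a bound for log |A|. -/
theorem exists_norm_aeval_ge {n : ℕ} {p : Fin n → Polynomial ℚ} {d L : ℕ}
    (hp : ∀ i, p i ≠ 0) (hd : ∀ i, (p i).natDegree ≤ d)
    (hL : ∀ i j, bitLen ((p i).coeff j).num ≤ L ∧ bitLen ((p i).coeff j).den ≤ L)
    {f : MvPolynomial (Fin n) ℚ} (hf : f.totalDegree ≤ d)
    {D : ℕ} (hD : D ≠ 0) (hDL : bitLen D ≤ L) (hden : ∀ e, (f.coeff e).den ∣ D)
    {α : Fin n → ℂ} (hα : ∀ i, Polynomial.aeval (α i) (p i) = 0)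
    (hfα : MvPolynomial.aeval α f ≠ 0) :
    ∃ α' : Fin n → ℂ, (∀ i, Polynomial.aeval (α' i) (p i) = 0) ∧
      1 ≤ 2 ^ (L + L * (d + 2) * n * d) * ‖MvPolynomial.aeval α' f‖ := by
  choose a ha0 hab hint using fun i => exists_isIntegral_mul_root (hp i) (hd i) (hL i)
  have hA : (D : ℤ) * (∏ i, a i) ^ d ≠ 0 :=
    mul_ne_zero (by exact_mod_cast hD) (pow_ne_zero _ (prod_ne_zero_iff.2 fun i _ => ha0 i))
  obtain ⟨α', hα', h⟩ := exists_one_le_norm_aeval hp hα hfα hA (by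
    rw [aeval_eq_sum_prod, mul_sum]
    refine IsIntegral.sum _ fun e he => ?_
    obtain ⟨c, hc⟩ := hden e
    have hDc : (D : ℂ) * ((f.coeff e : ℚ) : ℂ) = ((c * (f.coeff e).num : ℤ) : ℂ) := by
      have : (D : ℚ) * f.coeff e = ((c * (f.coeff e).num : ℤ) : ℚ) := by
        rw [hc]
        push_cast
        rw [mul_comm ((f.coeff e).den : ℚ), mul_assoc, mul_comm ((f.coeff e).den : ℚ),
          Rat.mul_den_eq_num]
      exact_mod_cast congrArg (Rat.cast : ℚ → ℂ) this
    -- Of the d copies of a_i, the monomial absorbs e_i to make its roots integral; the rest stays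
    -- as an integer factor.
    have hprod : (((∏ i, a i) ^ d : ℤ) : ℂ) * ∏ i, α i ^ e i =
        ∏ i, ((a i : ℂ) ^ (d - e i) * ((a i : ℂ) * α i) ^ e i) := by
      push_cast
      rw [← prod_pow, ← prod_mul_distrib]
      refine prod_congr rfl fun i _ => ?_
      have hei : e i ≤ d := (single_le_sum (f := fun i => e i) (fun _ _ => Nat.zero_le _)
        (mem_univ i)).trans (sum_le_of_mem_support hf he)
      rw [mul_pow, ← mul_assoc, ← pow_add, Nat.sub_add_cancel hei]
    have hall : (((D : ℤ) * (∏ i, a i) ^ d : ℤ) : ℂ) * (((f.coeff e : ℚ) : ℂ) * ∏ i, α i ^ e i) =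
        ((c * (f.coeff e).num : ℤ) : ℂ) *
          ∏ i, ((a i : ℂ) ^ (d - e i) * ((a i : ℂ) * α i) ^ e i) := by
      rw [← hDc, ← hprod]
      push_cast
      ring
    rw [hall]
    exact (isIntegral_algebraMap (R := ℤ)).mul (IsIntegral.prod _ fun i _ =>
      ((isIntegral_algebraMap (R := ℤ) (x := a i)).pow _).mul ((hint i _ (hα i)).pow _)))
  refine ⟨α', hα', h.trans ?_⟩
  gcongr
  push_cast
  rw [abs_mul, abs_pow, Finset.abs_prod, Nat.abs_cast, pow_add]
  gcongr
  · have := (bitLen_le.1 hDL).le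
    rw [Nat.abs_cast] at this
    exact_mod_cast this
  · rw [pow_mul _ (L * (d + 2) * n), pow_mul _ (L * (d + 2))]
    gcongr
    calc ∏ i, |(a i : ℝ)| ≤ ∏ _i : Fin n, (2 : ℝ) ^ (L * (d + 2)) :=
          prod_le_prod (fun _ _ => abs_nonneg _) fun i _ => hab i
      _ = _ := by simp

end Integrality

end

section

open Finset

/-! ### Approximate certificates for nonmembership -/

namespace BlackBoxMachine

variable {n : ℕ}

/-- The complex point with real parts `x 0 / q, …` and imaginary parts `x n / q, …`. -/
noncomputable def gridPoint (n : ℕ) (x : ℕ → ℤ) (q : ℤ) : Fin n → ℂ :=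
  fun i => ((x i : ℂ) + x (n + i) * Complex.I) / q

theorem natCast_add_one_le_two_pow (d : ℕ) : (d : ℝ) + 1 ≤ 2 ^ d := by
  exact_mod_cast (Nat.lt_two_pow_self : d < 2 ^ d)

theorem natCast_le_two_pow (d : ℕ) : (d : ℝ) ≤ 2 ^ d := by
  linarith [natCast_add_one_le_two_pow d]

theorem lipschitz_exponent_le (n d L : ℕ) :
    d * n + (L + (d + (2 * L + 2) * d)) ≤ 5 * (n + d + L + 1) ^ 2 ∧
    d + (L + (d + (2 * L + 2) * d)) ≤ 5 * (n + d + L + 1) ^ 2 := by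
  constructor <;> nlinarith [Nat.zero_le (d * n), Nat.zero_le (d * L), Nat.zero_le (n * L)]

/-- A power of two dominating the perturbation constant on the polydisc of radius 2^(2L+2), which
contains all roots and all points within distance 1 of them. -/
theorem multivariate_lipschitz_le (n d L : ℕ) {δ : ℝ} (hδ : 0 ≤ δ) :
    ((d : ℝ) + 1) ^ n * (2 ^ L * (d * (2 ^ (2 * L + 2)) ^ d * δ)) ≤
      2 ^ (5 * (n + d + L + 1) ^ 2) * δ := by
  calc ((d : ℝ) + 1) ^ n * (2 ^ L * (d * (2 ^ (2 * L + 2)) ^ d * δ))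
      ≤ (2 ^ d) ^ n * (2 ^ L * (2 ^ d * (2 ^ (2 * L + 2)) ^ d * δ)) := by
        gcongr
        · exact natCast_add_one_le_two_pow d
        · exact natCast_le_two_pow d
    _ = 2 ^ (d * n + (L + (d + (2 * L + 2) * d))) * δ := by
        rw [pow_add 2 (d * n), pow_add 2 L, pow_add 2 d, pow_mul 2 d n, pow_mul 2 (2 * L + 2) d]
        ring
    _ ≤ _ := by
        gcongr
        · norm_num
        · exact (lipschitz_exponent_le n d L).1

theorem univariate_lipschitz_le (n d L : ℕ) {δ : ℝ} (hδ : 0 ≤ δ) :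
    ((d : ℝ) + 1) * (2 ^ L * (d * (2 ^ (2 * L + 2)) ^ d * δ)) ≤
      2 ^ (5 * (n + d + L + 1) ^ 2) * δ := by
  calc ((d : ℝ) + 1) * (2 ^ L * (d * (2 ^ (2 * L + 2)) ^ d * δ))
      ≤ 2 ^ d * (2 ^ L * (2 ^ d * (2 ^ (2 * L + 2)) ^ d * δ)) := by
        gcongr
        · exact natCast_add_one_le_two_pow d
        · exact natCast_le_two_pow d
    _ = 2 ^ (d + (L + (d + (2 * L + 2) * d))) * δ := by
        rw [pow_add 2 d, pow_add 2 L, pow_add 2 d, pow_mul 2 (2 * L + 2) d]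
        ring
    _ ≤ _ := by
        gcongr
        · norm_num
        · exact (lipschitz_exponent_le n d L).2

theorem abs_floor_lt {y : ℝ} {k : ℕ} (h : |y| ≤ 2 ^ k) : |⌊y⌋| < 2 ^ (k + 1) := by
  have h1 := Int.floor_le y
  have h2 := Int.lt_floor_add_one y
  have h3 : (1 : ℝ) ≤ 2 ^ k := one_le_pow₀ (by norm_num)
  rw [abs_le] at h
  have h4 : (|⌊y⌋| : ℝ) < 2 ^ (k + 1) := by
    rw [pow_succ, abs_lt]
    constructor
    · rcases h3.eq_or_lt with h5 | h5
      · have : (-1 : ℝ) ≤ ⌊y⌋ := by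
          have : (-1 : ℤ) ≤ ⌊y⌋ := Int.le_floor.2 (by push_cast; linarith)
          exact_mod_cast this
        linarith
      · linarith
    · linarith
  exact_mod_cast h4

theorem norm_floor_sub_le (w : ℂ) {q : ℝ} (hq : 0 < q) :
    ‖((⌊q * w.re⌋ : ℂ) + ⌊q * w.im⌋ * Complex.I) / q - w‖ ≤ 2 * q⁻¹ := by
  have key : ∀ y : ℝ, |(⌊q * y⌋ : ℝ) / q - y| ≤ q⁻¹ := by
    intro y
    have h1 := Int.floor_le (q * y)
    have h2 := Int.lt_floor_add_one (q * y)
    have : (⌊q * y⌋ : ℝ) / q - y = (⌊q * y⌋ - q * y) * q⁻¹ := by field_simp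
    rw [this, abs_mul, abs_of_pos (inv_pos.2 hq)]
    refine mul_le_of_le_one_left (inv_pos.2 hq).le ?_
    rw [abs_le]; constructor <;> linarith
  have hre : (((⌊q * w.re⌋ : ℂ) + ⌊q * w.im⌋ * Complex.I) / q - w) =
      (((⌊q * w.re⌋ : ℝ) / q - w.re : ℝ) : ℂ) +
        (((⌊q * w.im⌋ : ℝ) / q - w.im : ℝ) : ℂ) * Complex.I := by
    push_cast
    linear_combination Complex.re_add_im w
  rw [hre]
  refine (norm_add_le _ _).trans ?_
  rw [norm_mul, Complex.norm_I, mul_one, Complex.norm_real, Complex.norm_real, two_mul]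
  exact add_le_add (key _) (key _)

/-- Forwards, a conjugate zero with |f| ≥ 2^(-3V) is rounded to the grid. Backwards, small values of
the `p i` give a zero α near z, and f(α) = 0 would make |f(z)| smaller than 2^(-4V). -/
theorem not_mem_iff_exists_gridPoint {d L V W : ℕ} (hV : V = (n + d + L + 1) ^ 4)
    (hW : W = (n + d + L + 1) ^ 5) {f : MvPolynomial (Fin n) ℚ} {p : Fin n → Polynomial ℚ}
    (hf : f.totalDegree ≤ d) (hd : ∀ i, (p i).natDegree ≤ d) (hp : ∀ i, HasDistinctRoots (p i))
    (hL : ∀ i j, bitLen ((p i).coeff j).num ≤ L ∧ bitLen ((p i).coeff j).den ≤ L)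
    (hfL : ∀ e, bitLen (f.coeff e).num ≤ L)
    (hD : ∃ D : ℕ, D ≠ 0 ∧ bitLen D ≤ L ∧ ∀ e, (f.coeff e).den ∣ D) :
    f ∉ univariateIdeal p ↔ ∃ x : ℕ → ℤ, (∀ j, |x j| < 2 ^ (22 * W)) ∧
      (∀ i, ‖Polynomial.aeval (gridPoint n x (2 ^ (18 * W)) i) (p i)‖ * 2 ^ (11 * W) < 1) ∧
      1 ≤ ‖MvPolynomial.aeval (gridPoint n x (2 ^ (18 * W))) f‖ * 2 ^ (4 * V) := by
  rw [not_mem_univariateIdeal_iff hp]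
  have hN2V : (n + d + L + 1) ^ 2 ≤ V := hV ▸ Nat.pow_le_pow_right (by omega) (by norm_num)
  have hNV : n + d + L + 1 ≤ V := hV ▸ Nat.le_self_pow (by norm_num) _
  have hWV : W = (n + d + L + 1) * V := by rw [hW, hV]; ring
  have hVW : V ≤ W := by rw [hWV]; nlinarith
  have hρ : (1 : ℝ) ≤ 2 ^ (2 * L + 2) := one_le_pow₀ (by norm_num)
  have hroot : ∀ i (w : ℂ), Polynomial.aeval w (p i) = 0 → ‖w‖ ≤ 2 ^ (2 * L + 1) :=
    fun i w hw => norm_root_le (hp i).1 (hL i) hw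
  have hρρ : (2 : ℝ) ^ (2 * L + 1) + 1 ≤ 2 ^ (2 * L + 2) := by
    have : (1 : ℝ) ≤ 2 ^ (2 * L + 1) := one_le_pow₀ (by norm_num)
    rw [show 2 * L + 2 = 2 * L + 1 + 1 by ring, pow_succ _ (2 * L + 1)]
    linarith
  have hnear : ∀ (w α : ℂ), ‖α‖ ≤ 2 ^ (2 * L + 1) → ‖w - α‖ ≤ 1 →
      ‖w‖ ≤ 2 ^ (2 * L + 2) := by
    intro w α hα hwα
    have := norm_add_le (w - α) α
    rw [sub_add_cancel] at this
    linarith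
  constructor
  · rintro ⟨α₀, hα₀, hfα₀⟩
    obtain ⟨D, hD0, hDL, hden⟩ := hD
    obtain ⟨α, hα, hfα⟩ := exists_norm_aeval_ge (fun i => (hp i).1) hd hL hf hD0 hDL hden hα₀ hfα₀
    have hH : L + L * (d + 2) * n * d ≤ 3 * V := by
      have h1 : L * (d + 2) * n * d ≤ (n + d + L + 1) * (2 * (n + d + L + 1)) *
          (n + d + L + 1) * (n + d + L + 1) := by
        gcongr <;> omega
      have h2 : (n + d + L + 1) * (2 * (n + d + L + 1)) * (n + d + L + 1) * (n + d + L + 1) =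
          2 * V := by rw [hV]; ring
      omega
    have hfα3 : 1 ≤ 2 ^ (3 * V) * ‖MvPolynomial.aeval α f‖ := hfα.trans (by
      gcongr
      norm_num)
    -- Real parts first, then imaginary parts; the value 0 beyond 2n keeps the size bound valid for
    -- all indices.
    let x : ℕ → ℤ := fun j => if h : j < n then ⌊(2 : ℝ) ^ (18 * W) * (α ⟨j, h⟩).re⌋
      else if h : j - n < n then ⌊(2 : ℝ) ^ (18 * W) * (α ⟨j - n, h⟩).im⌋ else 0
    have hq : (0 : ℝ) < 2 ^ (18 * W) := by positivity
    have hz : ∀ i, ‖gridPoint n x (2 ^ (18 * W)) i - α i‖ ≤ 2 * (2 ^ (18 * W))⁻¹ := by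
      intro i
      have h1 : x i = ⌊(2 : ℝ) ^ (18 * W) * (α i).re⌋ := by simp [x]
      have h2 : x (n + i) = ⌊(2 : ℝ) ^ (18 * W) * (α i).im⌋ := by simp [x]
      have := norm_floor_sub_le (α i) hq
      rw [gridPoint, h1, h2]
      push_cast at this ⊢
      exact this
    -- The rounding error: at most 1/q from the real part and 1/q from the imaginary part.
    set δ : ℝ := 2 * (2 ^ (18 * W))⁻¹ with hδdef
    have hδ0 : 0 ≤ δ := by positivity
    have hδpow : ∀ k : ℕ, k + 1 ≤ 18 * W → 2 ^ k * δ ≤ 1 := by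
      intro k hk
      rw [hδdef, ← mul_assoc, ← pow_succ, mul_inv_le_iff₀ hq, one_mul]
      exact pow_le_pow_right₀ (by norm_num) hk
    have hδ1 : δ ≤ 1 := by simpa using hδpow 0 (by omega)
    have hzn : ∀ i, ‖gridPoint n x (2 ^ (18 * W)) i‖ ≤ 2 ^ (2 * L + 2) := fun i =>
      hnear _ (α i) (hroot i _ (hα i)) ((hz i).trans hδ1)
    have hαn : ∀ i, ‖α i‖ ≤ 2 ^ (2 * L + 2) := fun i => by
      have := hroot i _ (hα i); linarith
    refine ⟨x, fun j => ?_, fun i => ?_, ?_⟩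
    · have hb : ∀ (i : Fin n) (y : ℝ), |y| ≤ ‖α i‖ → |⌊(2 : ℝ) ^ (18 * W) * y⌋| < 2 ^ (22 * W) := by
        intro i y hy
        -- Roots are at most 2^(2L+1), so the numerators need 18W + 2L + 2 ≤ 22W bits.
        refine (abs_floor_lt (k := 18 * W + (2 * L + 1)) ?_).trans_le
          (pow_le_pow_right₀ (by norm_num) (by omega))
        rw [abs_mul, pow_add, abs_of_pos hq]
        gcongr
        exact hy.trans (hroot i _ (hα i))
      simp only [x]
      split_ifs with h1 h2
      · exact hb _ _ (Complex.abs_re_le_norm _)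
      · exact hb _ _ (Complex.abs_im_le_norm _)
      · simp
    · have h1 := norm_polynomial_aeval_sub_le (hd i) (fun j => (hL i j).1) hρ (hzn i) (hαn i) (hz i)
      rw [hα i, sub_zero] at h1
      have h2 := h1.trans (univariate_lipschitz_le n d L hδ0)
      -- As N² ≤ V ≤ W, the precision 18W exceeds the exponents 5N² and 11W; the spare factor 2
      -- makes the inequality strict.
      have h3 := hδpow (5 * (n + d + L + 1) ^ 2 + 11 * W + 1) (by omega)
      have h4 : (0 : ℝ) < 2 ^ (11 * W) := by positivity
      rw [pow_succ, pow_add] at h3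
      have h5 := mul_le_mul_of_nonneg_right h2 h4.le
      nlinarith
    · have h1 := norm_aeval_sub_le hf hfL hρ hδ0 hzn hαn hz
      have h2 := h1.trans (multivariate_lipschitz_le n d L hδ0)
      have h3 := hδpow (5 * (n + d + L + 1) ^ 2 + 4 * V) (by omega)
      have h4 := norm_sub_norm_le (MvPolynomial.aeval α f)
        (MvPolynomial.aeval (gridPoint n x (2 ^ (18 * W))) f)
      rw [norm_sub_rev] at h4
      have h5 : (2 : ℝ) ≤ 2 ^ V := by
        calc (2 : ℝ) = 2 ^ 1 := by norm_num
          _ ≤ 2 ^ V := pow_le_pow_right₀ (by norm_num) (by omega)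
      have h6 : (2 : ℝ) ^ (4 * V) = 2 ^ (3 * V) * 2 ^ V := by rw [← pow_add]; congr 1; ring
      -- After scaling by 2^(4V) the value at α is at least 2 and the error at most 1.
      have h7 : (2 : ℝ) ≤ ‖MvPolynomial.aeval α f‖ * 2 ^ (4 * V) := by
        rw [h6, ← mul_assoc, mul_comm ‖_‖]
        nlinarith
      rw [pow_add] at h3
      have h8 : (0 : ℝ) < 2 ^ (4 * V) := by positivity
      have h9 := mul_le_mul_of_nonneg_right h2 h8.le
      have h10 := mul_le_mul_of_nonneg_right h4 h8.le
      nlinarith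
  · rintro ⟨x, -, hroots, hval⟩
    set z := gridPoint n x (2 ^ (18 * W)) with hzdef
    have hδ0 : (0 : ℝ) < (2 ^ (10 * V))⁻¹ := by positivity
    have hδ1 : ((2 : ℝ) ^ (10 * V))⁻¹ ≤ 1 := inv_le_one_of_one_le₀ (one_le_pow₀ (by norm_num))
    have hex : ∀ i, ∃ α : ℂ, Polynomial.aeval α (p i) = 0 ∧
        ‖z i - α‖ ≤ ((2 : ℝ) ^ (10 * V))⁻¹ := by
      intro i
      refine exists_root_near (hp i).1 (hd i) (fun j => (hL i j).2) hδ0 hδ1 ?_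
      have h1 := hroots i
      have h2 : (0 : ℝ) < 2 ^ (11 * W) := by positivity
      rw [← lt_div_iff₀ h2] at h1
      refine h1.trans_le ?_
      -- A root within 2^(-10V) requires 2^(-11W) ≤ 2^(-L-10Vd), which holds because W = NV.
      rw [inv_pow, ← mul_inv, ← pow_mul, ← pow_add, one_div]
      gcongr
      · norm_num
      · rw [hWV]
        nlinarith [Nat.zero_le (n * V), Nat.zero_le (L * V), Nat.zero_le (d * V)]
    choose α hα hzα using hex
    refine ⟨α, hα, fun h0 => ?_⟩
    have hzn : ∀ i, ‖z i‖ ≤ 2 ^ (2 * L + 2) := fun i =>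
      hnear _ (α i) (hroot i _ (hα i)) ((hzα i).trans hδ1)
    have hαn : ∀ i, ‖α i‖ ≤ 2 ^ (2 * L + 2) := fun i => by
      have := hroot i _ (hα i); linarith
    have h1 := (norm_aeval_sub_le hf hfL hρ hδ0.le hzn hαn hzα).trans
      (multivariate_lipschitz_le n d L hδ0.le)
    rw [h0, sub_zero] at h1
    have h2 : (2 : ℝ) ^ (5 * (n + d + L + 1) ^ 2) * (2 ^ (10 * V))⁻¹ * 2 ^ (4 * V) < 1 := by
      rw [mul_right_comm, ← pow_add, ← div_eq_mul_inv, div_lt_one (by positivity)]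
      exact pow_lt_pow_right₀ (by norm_num) (by omega)
    have h8 : (0 : ℝ) < 2 ^ (4 * V) := by positivity
    have h9 := mul_le_mul_of_nonneg_right h1 h8.le
    linarith

/-! ### The answers of the black box -/

/-- D·q^d clears the denominator of f(y/q), so the reduced denominator divides it; the numerator is
the value times that denominator, and the value is bounded by the size of the coordinates. -/
theorem bitLen_answer_le {d L k : ℕ} {f : MvPolynomial (Fin n) ℚ} (hf : f.totalDegree ≤ d)
    (hfL : ∀ e, bitLen (f.coeff e).num ≤ L)
    (hD : ∃ D : ℕ, D ≠ 0 ∧ bitLen D ≤ L ∧ ∀ e, (f.coeff e).den ∣ D)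
    {y : Fin n → ℤ} {q : ℤ} (hq : 0 < q) (hqk : q < 2 ^ k) (hy : ∀ i, |y i| ≤ 2 ^ k) :
    bitLen (MvPolynomial.eval (fun i => (y i : ℚ) / q) f).num ≤ 2 * L + d * n + 2 * k * d + 1 ∧
    bitLen (MvPolynomial.eval (fun i => (y i : ℚ) / q) f).den ≤ 2 * L + d * n + 2 * k * d + 1 := by
  obtain ⟨D, hD0, hDL, hden⟩ := hD
  set r := MvPolynomial.eval (fun i => (y i : ℚ) / q) f with hr
  have hqQ : (q : ℚ) ≠ 0 := by exact_mod_cast hq.ne'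
  have hint : ∃ w : ℤ, (D * q ^ d : ℤ) * r = w := by
    have hsum : (D * q ^ d : ℤ) * r = ∑ e ∈ f.support, ((D : ℚ) * f.coeff e) *
        ((∏ i, (y i : ℚ) ^ e i) * (q : ℚ) ^ (d - ∑ i, e i)) := by
      rw [hr, MvPolynomial.eval_eq', mul_sum]
      refine sum_congr rfl fun e he => ?_
      have h1 : (q : ℚ) ^ d = q ^ (d - ∑ i, e i) * ∏ i, (q : ℚ) ^ e i := by
        rw [prod_pow_eq_pow_sum, ← pow_add, Nat.sub_add_cancel (sum_le_of_mem_support hf he)]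
      have h2 : (∏ i, ((y i : ℚ) / q) ^ e i) * ∏ i, (q : ℚ) ^ e i = ∏ i, (y i : ℚ) ^ e i := by
        rw [← prod_mul_distrib]
        refine prod_congr rfl fun i _ => ?_
        rw [← mul_pow, div_mul_cancel₀ _ hqQ]
      push_cast
      rw [h1, ← h2]
      ring
    choose c hc using fun e => hden e
    refine ⟨∑ e ∈ f.support, (c e * (f.coeff e).num) *
      ((∏ i, y i ^ e i) * q ^ (d - ∑ i, e i)), ?_⟩
    rw [hsum]
    push_cast
    refine sum_congr rfl fun e _ => ?_
    congr 1
    have h1 : (D : ℚ) = (f.coeff e).den * c e := by exact_mod_cast hc e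
    rw [h1, mul_comm ((f.coeff e).den : ℚ), mul_assoc, mul_comm ((f.coeff e).den : ℚ),
      Rat.mul_den_eq_num]
  obtain ⟨w, hw⟩ := hint
  have hM0 : (0 : ℤ) < D * q ^ d := by
    have : (0 : ℤ) < D := by exact_mod_cast Nat.pos_of_ne_zero hD0
    positivity
  have hdvd : (r.den : ℤ) ∣ D * q ^ d := by
    have h1 : r = Rat.divInt w (D * q ^ d) := by
      rw [Rat.divInt_eq_div, ← hw, mul_div_cancel_left₀]
      exact_mod_cast hM0.ne'
    rw [h1]
    exact Rat.den_dvd _ _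
  have hdenM : (r.den : ℝ) ≤ 2 ^ (L + k * d) := by
    have h1 : (r.den : ℤ) ≤ D * q ^ d := Int.le_of_dvd hM0 hdvd
    have h2 : (D : ℤ) ≤ 2 ^ L := by
      have := (bitLen_le.1 hDL).le
      rwa [Nat.abs_cast] at this
    have h3 : (D : ℤ) * q ^ d ≤ 2 ^ L * (2 ^ k) ^ d := by gcongr
    rw [← pow_mul, ← pow_add] at h3
    exact_mod_cast h1.trans h3
  have hrn : ‖(r : ℂ)‖ ≤ 2 ^ (d * n + (L + k * d)) := by
    rw [hr, ratCast_eval]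
    refine (norm_aeval_le (ρ := 2 ^ k) hf hfL (one_le_pow₀ (by norm_num)) fun i => ?_).trans ?_
    · rw [Rat.cast_div, Rat.cast_intCast, Rat.cast_intCast, norm_div, Complex.norm_intCast,
        Complex.norm_intCast]
      have h1 : (1 : ℝ) ≤ |(q : ℝ)| := by
        rw [abs_of_pos (by exact_mod_cast hq)]
        exact_mod_cast hq
      refine (div_le_self (abs_nonneg _) h1).trans ?_
      exact_mod_cast hy i
    · rw [pow_add, pow_add, pow_mul, pow_mul]
      gcongr
      exact natCast_add_one_le_two_pow d
  have hnum : (|(r.num : ℝ)|) ≤ 2 ^ (d * n + (L + k * d)) * 2 ^ (L + k * d) := by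
    have h1 : (r.num : ℚ) = r * r.den := (Rat.mul_den_eq_num r).symm
    have h2 : |(r.num : ℝ)| = ‖(r : ℂ)‖ * r.den := by
      rw [← Complex.norm_intCast, ← Complex.norm_natCast, ← norm_mul]
      congr 1
      exact_mod_cast congrArg (Rat.cast : ℚ → ℂ) h1
    rw [h2]
    gcongr
  constructor <;> rw [bitLen_le]
  · rw [← pow_add] at hnum
    have h1 : |r.num| ≤ 2 ^ (d * n + (L + k * d) + (L + k * d)) := by exact_mod_cast hnum
    refine h1.trans_lt (pow_lt_pow_right₀ (by norm_num) ?_)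
    nlinarith
  · rw [Nat.abs_cast]
    have h1 : (r.den : ℤ) ≤ 2 ^ (L + k * d) := by exact_mod_cast hdenM
    refine h1.trans_lt (pow_lt_pow_right₀ (by norm_num) ?_)
    nlinarith [Nat.zero_le (d * n), Nat.zero_le (k * d)]

end BlackBoxMachine

end

section

open Finset

namespace BlackBoxMachine

/-! ### Polynomial bounds -/

/-- `T` is bounded by a polynomial. -/
def PolyBounded (T : ℕ → ℕ) : Prop := ∃ c k : ℕ, ∀ N, 1 ≤ N → T N ≤ c * N ^ k

theorem PolyBounded.const (a : ℕ) : PolyBounded fun _ => a := ⟨a, 0, fun _ _ => by simp⟩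

theorem PolyBounded.id : PolyBounded fun N => N := ⟨1, 1, fun _ _ => by simp⟩

theorem PolyBounded.add {S T : ℕ → ℕ} (hS : PolyBounded S) (hT : PolyBounded T) :
    PolyBounded fun N => S N + T N := by
  obtain ⟨c, k, h⟩ := hS
  obtain ⟨c', k', h'⟩ := hT
  refine ⟨c + c', k + k', fun N hN => ?_⟩
  calc S N + T N ≤ c * N ^ k + c' * N ^ k' := add_le_add (h N hN) (h' N hN)
    _ ≤ c * N ^ (k + k') + c' * N ^ (k + k') := by gcongr <;> omega
    _ = _ := by ring

theorem PolyBounded.mul {S T : ℕ → ℕ} (hS : PolyBounded S) (hT : PolyBounded T) :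
    PolyBounded fun N => S N * T N := by
  obtain ⟨c, k, h⟩ := hS
  obtain ⟨c', k', h'⟩ := hT
  refine ⟨c * c', k + k', fun N hN => ?_⟩
  calc S N * T N ≤ (c * N ^ k) * (c' * N ^ k') := Nat.mul_le_mul (h N hN) (h' N hN)
    _ = _ := by ring

theorem PolyBounded.pow {S : ℕ → ℕ} (hS : PolyBounded S) (m : ℕ) :
    PolyBounded fun N => S N ^ m := by
  induction m with
  | zero => simpa using PolyBounded.const 1
  | succ m ih => simpa only [pow_succ] using ih.mul hS

/-! ### The algorithm -/

/-- Guess a point close to a common zero, and check that the polynomial does not vanish there. -/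
def nonmembershipProgram : Program :=
  .seq setup (.seq guessPhase (.seq rootPhase valuePhase))

/-- A bound for the bit length of all numbers that occur. -/
def cellBound (N : ℕ) : ℕ := 500 * N ^ 8

/-- A bound for the running time. -/
def timeBound (N : ℕ) : ℕ :=
  setupTime (N ^ 4) (N ^ 5) (cellBound N) + (guessTime N (N ^ 5) (cellBound N) +
    (rootTime N N (cellBound N) + valueTime N N (cellBound N) + 1) + 1) + 1

/-- The bound is built by sums, products and powers from N and constants; the growth and cost
factors belong to the fixed program and do not depend on N. -/
theorem polyBounded_timeBound : PolyBounded timeBound := by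
  unfold timeBound setupTime guessTime rootTime valueTime hornerTime nodeTime weightTime pointTime
    cellBound
  repeat' with_reducible first
    | exact PolyBounded.const _
    | exact PolyBounded.id
    | refine PolyBounded.pow ?_ _
    | refine PolyBounded.add ?_ ?_
    | refine PolyBounded.mul ?_ ?_

variable {n : ℕ}

theorem hornerVal_eq_sum (z : ℂ) (c : ℕ → ℂ) (m : ℕ) :
    hornerVal z c m = ∑ j ∈ range m, c j * z ^ (m - 1 - j) := by
  induction m with
  | zero => simp [hornerVal]
  | succ m ih =>
    rw [hornerVal, ih, sum_range_succ, sum_mul]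
    simp only [Nat.add_sub_cancel, Nat.sub_self, pow_zero, mul_one]
    congr 1
    refine sum_congr rfl fun j hj => ?_
    rw [mul_assoc, ← pow_succ]
    congr 2
    have := mem_range.1 hj
    omega

theorem hornerVal_coeff {p : Polynomial ℚ} {d : ℕ} (hd : p.natDegree ≤ d) (z : ℂ) :
    hornerVal z (fun j => ((p.coeff (d - j)).num : ℂ) / ((p.coeff (d - j)).den : ℤ)) (d + 1) =
      Polynomial.aeval z p := by
  rw [hornerVal_eq_sum, Polynomial.aeval_eq_sum_range' (Nat.lt_succ_of_le hd),
    ← sum_range_reflect (fun j => p.coeff j • z ^ j)]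
  refine sum_congr rfl fun j _ => ?_
  rw [Rat.smul_def, Nat.add_sub_cancel, Int.cast_natCast, ← Rat.cast_def]

theorem bdd_inputMemory {d L b : ℕ} {p : Fin n → Polynomial ℚ}
    (hL : ∀ i j, bitLen ((p i).coeff j).num ≤ L ∧ bitLen ((p i).coeff j).den ≤ L)
    (hb : n + d + L ≤ b) : Bdd b (inputMemory d L p) := by
  intro x z
  unfold inputMemory
  split_ifs
  · exact bitLen_natCast_le_of_le (by omega)
  · exact bitLen_natCast_le_of_le (by omega)
  · exact bitLen_natCast_le_of_le (by omega)
  · simp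
  · exact (hL _ _).1.trans (by omega)
  · exact (hL _ _).2.trans (by omega)
  · simp
  · simp

theorem inputMemory_coeff {d L : ℕ} (p : Fin n → Polynomial ℚ) (k : Fin n) {j : ℕ} (hj : j ≤ d) :
    inputMemory d L p 1 ((k : ℕ) * (d + 1) + (d - j)) = ((p k).coeff (d - j)).num ∧
    inputMemory d L p 2 ((k : ℕ) * (d + 1) + (d - j)) = ((p k).coeff (d - j)).den := by
  have e : (((k : ℕ) : ℤ) * (d + 1) + (d - j)) = (((k : ℕ) * (d + 1) + (d - j) : ℕ) : ℤ) := by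
    push_cast [Nat.cast_sub hj]
    ring
  have hdiv : ((k : ℕ) * (d + 1) + (d - j)) / (d + 1) = k := by
    rw [mul_comm, Nat.mul_add_div (Nat.succ_pos d), Nat.div_eq_of_lt (by omega), add_zero]
  have hmod : ((k : ℕ) * (d + 1) + (d - j)) % (d + 1) = d - j := by
    rw [mul_comm, Nat.mul_add_mod, Nat.mod_eq_of_lt (by omega)]
  rw [e]
  simp only [inputMemory, Int.toNat_natCast, hdiv, hmod, Fin.eta, Nat.cast_nonneg, true_and,
    Fin.is_lt]
  simp

theorem nonmembershipProgram_run {F : (Fin n → ℚ) → ℚ} {s : State} {b d L V W β : ℕ}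
    {x : ℕ → ℤ} {q : ℤ} {ν δ : ℕ → ℕ → ℤ}
    (hV : V = (n + d + L + 1) ^ 4) (hW : W = (n + d + L + 1) ^ 5) (hq : q = 2 ^ (18 * W))
    (hx : ∀ j, x j = guessVal s.guesses (22 * W) j (22 * W))
    (hβ : 1 ≤ β) (hdβ : d ≤ β) (hnb : n ≤ b) (hWb : 18 * W + 1 ≤ b) (hWb' : 22 * W ≤ b)
    (hWb'' : 2 * n * (22 * W) ≤ b) (hβb : 1 + 4 * β * (d + 1) ≤ b)
    (hβb' : 1 + (d + 1) * (β + (1 + 2 * β * (d + 1)) + 1) ≤ b) (hb : Bdd b s.mem)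
    (h0 : s.mem 0 0 = n) (h1 : s.mem 0 1 = d) (h2 : s.mem 0 2 = L) (h4 : ∀ j : ℕ, s.mem 4 j = 0)
    (hν : ∀ k < n, ∀ j ≤ d, s.mem 1 (k * (d + 1) + (d - j)) = ν k j)
    (hδ : ∀ k < n, ∀ j ≤ d, s.mem 2 (k * (d + 1) + (d - j)) = δ k j)
    (hδ0 : ∀ k j, δ k j ≠ 0)
    (hxb : ∀ k, bitLen (x k) ≤ β) (hqb : bitLen q ≤ β)
    (hνb : ∀ k j, bitLen (ν k j) ≤ β) (hδb : ∀ k j, bitLen (δ k j) ≤ β)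
    (hnum : ∀ k ≤ d, bitLen (F (nodePoint n x q k)).num ≤ β)
    (hden : ∀ k ≤ d, bitLen (F (nodePoint n x q k)).den ≤ β) :
    Triple F nonmembershipProgram s
      (setupTime V W b + (guessTime n W b + (rootTime n d b + valueTime n d b + 1) + 1) + 1)
      fun s' => s'.mem 3 0 = 1 ↔
        (∀ k < n, ‖hornerVal ((x k + x (n + k) * Complex.I) / q) (fun j => ν k j / δ k j)
          (d + 1)‖ * ((2 ^ (11 * W) : ℤ) : ℝ) < 1) ∧
        1 ≤ ‖lagrangeSum F x q d (d + 1)‖ * ((2 ^ (4 * V) : ℤ) : ℝ) := by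
  have hW0 : 0 < W := by rw [hW]; positivity
  have hq0 : q ≠ 0 := by rw [hq]; positivity
  refine Triple.seq (setup_spec hV hW hWb hb h0 h1 h2)
    fun s₁ f₁ ⟨hb₁, hg₁, h3₁, h8₁, h11₁, h12₁, h13₁⟩ => ?_
  refine Triple.seq (guessPhase_spec (W := W) hW0 hWb'' hWb' hb₁
    (by rw [f₁ 0 (by decide), h0]) h8₁ (fun j => by rw [f₁ 4 (by decide), h4]))
    fun s₂ f₂ ⟨hb₂, h4₂⟩ => ?_
  rw [hg₁] at h4₂
  have h4₂' : ∀ k < 2 * n, s₂.mem 4 (k : ℕ) = x k := fun k hk => by rw [h4₂ k hk, hx]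
  refine Triple.seq (rootPhase_spec (K := 2 ^ (11 * W)) hβ hβb hnb hb₂ (by rw [f₂ 0 (by decide), f₁ 0 (by decide), h0])
    (by rw [f₂ 0 (by decide), f₁ 0 (by decide), h1]) h4₂'
    (by rw [f₂ 13 (by decide), h13₁, hq]) hq0 (by rw [f₂ 12 (by decide), h12₁]) (by positivity)
    (fun k hk j hj => by rw [f₂ 1 (by decide), f₁ 1 (by decide), hν k hk j hj])
    (fun k hk j hj => by rw [f₂ 2 (by decide), f₁ 2 (by decide), hδ k hk j hj])
    hδ0 hxb hqb hνb hδb (by rw [f₂ 3 (by decide), h3₁])) fun s₃ f₃ ⟨hb₃, hok⟩ => ?_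
  refine (valuePhase_spec (K := 2 ^ (4 * V)) hβ hdβ hnb hβb' hb₃
    (by rw [f₃ 0 (by decide), f₂ 0 (by decide), f₁ 0 (by decide), h0])
    (by rw [f₃ 0 (by decide), f₂ 0 (by decide), f₁ 0 (by decide), h1])
    (fun k hk => by rw [f₃ 4 (by decide), h4₂' k hk])
    (by rw [f₃ 13 (by decide), f₂ 13 (by decide), h13₁, hq])
    (by rw [f₃ 11 (by decide), f₂ 11 (by decide), h11₁]) (by positivity) hxb hqb hnum
    hden).weaken le_rfl fun s₄ _ hfin => ?_
  rw [hfin, hok]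

theorem le_timeBound {d L N : ℕ} (hN : N = n + d + L + 1) :
    setupTime (N ^ 4) (N ^ 5) (cellBound N) + (guessTime n (N ^ 5) (cellBound N) +
      (rootTime n d (cellBound N) + valueTime n d (cellBound N) + 1) + 1) + 1 ≤ timeBound N := by
  have hn' : n ≤ N := by omega
  have hd' : d ≤ N := by omega
  generalize hb : cellBound N = b
  rw [timeBound, hb]
  have h1 : guessTime n (N ^ 5) b ≤ guessTime N (N ^ 5) b := by
    unfold guessTime; gcongr
  have h2 : hornerTime d b ≤ hornerTime N b := by
    unfold hornerTime; gcongr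
  have h3 : rootTime n d b ≤ rootTime N N b := by
    unfold rootTime; gcongr
  have h4 : weightTime d b ≤ weightTime N b := by
    unfold weightTime; gcongr
  have h5 : pointTime n b ≤ pointTime N b := by
    unfold pointTime; gcongr
  have h6 : nodeTime n d b ≤ nodeTime N N b := by
    unfold nodeTime; gcongr
  have h7 : valueTime n d b ≤ valueTime N N b := by
    unfold valueTime; gcongr
  omega

/-- β bounds the data entering the evaluation phases: coefficients, guessed numerators, the
denominator and the answers. Horner needs order βN bits and interpolation order βN², all within
10βN² = 500N⁸. -/
theorem cellBound_bounds {d L N W β : ℕ} (hN : N = n + d + L + 1) (hW : W = N ^ 5)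
    (hβ : β = 50 * (W * N)) : N ≤ W ∧ 50 * W ≤ β ∧ β ≤ cellBound N ∧
      1 + 4 * β * (d + 1) ≤ cellBound N ∧
      1 + (d + 1) * (β + (1 + 2 * β * (d + 1)) + 1) ≤ cellBound N ∧
      2 * n * (22 * W) ≤ cellBound N ∧ 2 * L + d * n + 2 * (23 * W) * d + 1 ≤ β := by
  have hNW : N ≤ W := hW ▸ Nat.le_self_pow (by norm_num) _
  have hN1 : 1 ≤ N := by omega
  have hWβ : 50 * W ≤ β := by rw [hβ]; nlinarith
  have hbβ : cellBound N = 10 * (β * (N * N)) := by rw [hβ, hW, cellBound]; ring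
  have hββ : β ≤ β * (N * N) := Nat.le_mul_of_pos_right _ (by positivity)
  have hNN : N ≤ N * N := Nat.le_mul_of_pos_left _ hN1
  rw [hbβ]
  refine ⟨hNW, hWβ, by omega, ?_, ?_, ?_, ?_⟩
  · have h1 : β * (d + 1) ≤ β * (N * N) := Nat.mul_le_mul_left _ (by omega)
    nlinarith
  · have h1 : (d + 1) * (β + (1 + 2 * β * (d + 1)) + 1) ≤
        N * (β + (1 + 2 * β * N) + 1) := by gcongr <;> omega
    have h2 : β * N ≤ β * (N * N) := Nat.mul_le_mul_left _ hNN
    have h3 : N ≤ β := by omega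
    nlinarith
  · have h1 : n * W ≤ N * W := Nat.mul_le_mul_right _ (by omega)
    have h2 : 2 * n * (22 * W) ≤ 50 * (W * N) := by nlinarith
    omega
  · have h1 : d * n ≤ W * N := Nat.mul_le_mul (by omega) (by omega)
    have h2 : W * d + W ≤ W * N := by
      rw [← Nat.mul_succ]
      exact Nat.mul_le_mul_left _ (by omega)
    have h3 : N ≤ W * N := Nat.le_mul_of_pos_left _ (by omega)
    rw [hβ]
    nlinarith

/-- The coordinates a + kb with k < W exceed the guessed size by a factor of at most 2^W, whence 23W
= 22W + W. -/
theorem bitLen_eval_nodePoint_le {d L W k : ℕ} {f : MvPolynomial (Fin n) ℚ} {x : ℕ → ℤ} {q : ℤ}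
    (hf : f.totalDegree ≤ d) (hfL : ∀ e, bitLen (f.coeff e).num ≤ L)
    (hD : ∃ D : ℕ, D ≠ 0 ∧ bitLen D ≤ L ∧ ∀ e, (f.coeff e).den ∣ D)
    (hW : 0 < W) (hq : q = 2 ^ (18 * W)) (hx : ∀ j, |x j| < 2 ^ (22 * W)) (hk : k < W) :
    bitLen (MvPolynomial.eval (nodePoint n x q k) f).num ≤
        2 * L + d * n + 2 * (23 * W) * d + 1 ∧
      bitLen (MvPolynomial.eval (nodePoint n x q k) f).den ≤
        2 * L + d * n + 2 * (23 * W) * d + 1 := by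
  refine bitLen_answer_le (k := 23 * W) hf hfL hD (q := q)
    (y := fun i : Fin n => x i + k * x (n + i)) (by rw [hq]; positivity)
    (by rw [hq]; exact pow_lt_pow_right₀ (by norm_num) (by omega)) fun i => ?_
  have h3 : ((k : ℤ) + 1) ≤ 2 ^ W := by
    have h4 : k + 1 ≤ 2 ^ W := by
      have := Nat.lt_two_pow_self (n := W)
      omega
    exact_mod_cast h4
  calc |x i + k * x (n + i)| ≤ |x i| + |(k : ℤ) * x (n + i)| := abs_add_le _ _
    _ ≤ 2 ^ (22 * W) + k * 2 ^ (22 * W) := by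
      rw [abs_mul, Nat.abs_cast]
      exact add_le_add (hx _).le (mul_le_mul_of_nonneg_left (hx _).le (Nat.cast_nonneg _))
    _ = (k + 1) * 2 ^ (22 * W) := by ring
    _ ≤ 2 ^ W * 2 ^ (22 * W) := by gcongr
    _ = 2 ^ (23 * W) := by rw [← pow_add]; congr 1; ring

theorem nonmembershipProgram_spec {d L W V : ℕ} {f : MvPolynomial (Fin n) ℚ}
    {p : Fin n → Polynomial ℚ} (hV : V = (n + d + L + 1) ^ 4) (hW : W = (n + d + L + 1) ^ 5)
    (hf : f.totalDegree ≤ d) (hd : ∀ i, (p i).natDegree ≤ d)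
    (hL : ∀ i j, bitLen ((p i).coeff j).num ≤ L ∧ bitLen ((p i).coeff j).den ≤ L)
    (hfL : ∀ e, bitLen (f.coeff e).num ≤ L)
    (hD : ∃ D : ℕ, D ≠ 0 ∧ bitLen D ≤ L ∧ ∀ e, (f.coeff e).den ∣ D) (g : ℕ → Bool) :
    Triple (fun a => MvPolynomial.eval a f) nonmembershipProgram ⟨inputMemory d L p, g⟩
      (timeBound (n + d + L + 1)) fun s' => s'.mem 3 0 = 1 ↔
        (∀ i, ‖Polynomial.aeval (gridPoint n (fun j => guessVal g (22 * W) j (22 * W))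
          (2 ^ (18 * W)) i) (p i)‖ * 2 ^ (11 * W) < 1) ∧
        1 ≤ ‖MvPolynomial.aeval (gridPoint n (fun j => guessVal g (22 * W) j (22 * W))
          (2 ^ (18 * W))) f‖ * 2 ^ (4 * V) := by
  obtain ⟨N, hN⟩ : ∃ N, N = n + d + L + 1 := ⟨_, rfl⟩
  obtain ⟨β, hβ⟩ : ∃ β, β = 50 * (W * N) := ⟨_, rfl⟩
  obtain ⟨q, hq⟩ : ∃ q : ℤ, q = 2 ^ (18 * W) := ⟨_, rfl⟩
  obtain ⟨x, hx⟩ : ∃ x : ℕ → ℤ, x = fun j => guessVal g (22 * W) j (22 * W) := ⟨_, rfl⟩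
  have hxlt : ∀ j, |x j| < 2 ^ (22 * W) := fun j => by
    rw [hx]; exact abs_guessVal_lt g (22 * W) j (22 * W)
  obtain ⟨hNW, hWβ, hβb, hb1, hb2, hb3, hans⟩ := cellBound_bounds (n := n) hN (by rw [hW, hN]) hβ
  have hanswer := fun k (hk : k ≤ d) =>
    bitLen_eval_nodePoint_le hf hfL hD (by omega) hq hxlt (k := k) (by omega)
  rw [← hN] at hV hW ⊢
  rw [← hx, ← hq]
  let ν : ℕ → ℕ → ℤ := fun k j => if h : k < n then ((p ⟨k, h⟩).coeff (d - j)).num else 0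
  -- The value 1 outside the range keeps the denominators nonzero for all indices.
  let δ : ℕ → ℕ → ℤ := fun k j => if h : k < n then ((p ⟨k, h⟩).coeff (d - j)).den else 1
  refine (nonmembershipProgram_run (F := fun a => MvPolynomial.eval a f)
    (s := ⟨inputMemory d L p, g⟩) (b := cellBound N) (x := x) (q := q) (ν := ν) (δ := δ) (β := β)
    (V := V) (W := W) (L := L) (d := d)
    (by rw [hV, hN]) (by rw [hW, hN]) hq (fun j => by rw [hx]) (by omega) (by omega) (by omega)
    (by omega) (by omega) hb3 hb1 hb2 (bdd_inputMemory hL (by omega)) (by simp [inputMemory])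
    (by simp [inputMemory]) (by simp [inputMemory]) (by simp [inputMemory]) ?_ ?_ ?_
    (fun j => (bitLen_le.2 (hxlt j)).trans (by omega)) ?_ ?_ ?_
    (fun k hk => (hanswer k hk).1.trans hans) (fun k hk => (hanswer k hk).2.trans hans)).weaken
    ?_ fun s' _ hs' => ?_
  · intro k hk j hj
    simpa [ν, hk] using (inputMemory_coeff p ⟨k, hk⟩ hj).1
  · intro k hk j hj
    simpa [δ, hk] using (inputMemory_coeff p ⟨k, hk⟩ hj).2
  · intro k j
    simp only [δ]
    split_ifs
    · exact_mod_cast Rat.den_ne_zero _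
    · exact one_ne_zero
  · rw [hq]; exact bitLen_two_pow_le (by omega)
  · intro k j
    simp only [ν]
    split_ifs
    · exact (hL _ _).1.trans (by omega)
    · simp
  · intro k j
    simp only [δ]
    split_ifs
    · exact (hL _ _).2.trans (by omega)
    · rw [bitLen_one]; omega
  · rw [hV, hW]
    exact le_timeBound hN
  · rw [hs', lagrangeSum_eq hf, Fin.forall_iff]
    refine and_congr (forall₂_congr fun k hk => ?_) ?_
    · have : (fun j => (ν k j : ℂ) / δ k j) = fun j => (((p ⟨k, hk⟩).coeff (d - j)).num : ℂ) /
          (((p ⟨k, hk⟩).coeff (d - j)).den : ℤ) := by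
        funext j; simp [ν, δ, hk]
      rw [this, hornerVal_coeff (hd _), Int.cast_pow, Int.cast_ofNat]
      rfl
    · rw [Int.cast_pow, Int.cast_ofNat]
      rfl

end BlackBoxMachine

end

/-! ### The main theorem -/

theorem theorem1p8 :
    ∃ (P : BlackBoxMachine.Program) (c k : ℕ),
      ∀ (n d L : ℕ) (f : MvPolynomial (Fin n) ℚ) (p : Fin n → Polynomial ℚ),
        f.totalDegree ≤ d →
        (∀ i, (p i).natDegree ≤ d) →
        (∀ i, HasDistinctRoots (p i)) →
        (∀ i j, BlackBoxMachine.bitLen ((p i).coeff j).num ≤ L ∧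
          BlackBoxMachine.bitLen ((p i).coeff j).den ≤ L) →
        (∀ e, BlackBoxMachine.bitLen (f.coeff e).num ≤ L) →
        (∃ D : ℕ, D ≠ 0 ∧ BlackBoxMachine.bitLen D ≤ L ∧ ∀ e, (f.coeff e).den ∣ D) →
        BlackBoxMachine.HaltsWithin (fun a => MvPolynomial.eval a f) P
            (BlackBoxMachine.inputMemory d L p) (c * (n + d + L + 1) ^ k) ∧
          (f ∉ univariateIdeal p ↔
            BlackBoxMachine.Accepts (fun a => MvPolynomial.eval a f) P
              (BlackBoxMachine.inputMemory d L p)) := by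
  open BlackBoxMachine in
  obtain ⟨c, k, hT⟩ := polyBounded_timeBound
  refine ⟨nonmembershipProgram, c, k, fun n d L f p hf hd hp hL hfL hD => ?_⟩
  have hspec := nonmembershipProgram_spec rfl rfl hf hd hL hfL hD
  refine ⟨fun g => ?_, ?_⟩
  · obtain ⟨t, s, hex, ht, -⟩ := hspec g
    exact ⟨t, s, hex, ht.trans (hT _ (by omega))⟩
  · rw [not_mem_iff_exists_gridPoint rfl rfl hf hd hp hL hfL hD]
    constructor
    · rintro ⟨x, hx, hgood⟩
      obtain ⟨g, hg⟩ := exists_guessVal_eq (by positivity) x hx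
      obtain ⟨t, s, hex, -, hs⟩ := hspec g
      refine ⟨g, t, s, hex, hs.2 ?_⟩
      simp only [hg]
      exact hgood
    · rintro ⟨g, t, s, hex, hacc⟩
      obtain ⟨t', s', hex', -, hs⟩ := hspec g
      -- The accepting run is the specified run for its guesses, so these guesses encode a
      -- certificate.
      obtain ⟨-, rfl⟩ := hex.deterministic hex'
      exact ⟨_, fun j => abs_guessVal_lt g _ j _, hs.1 hacc⟩
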